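/- Throughout, graphs are finite and undirected; parallel edges and loops are allowed. A matching of $G$ is a set of non-loop edges no two of which share a vertex; it is perfect if it covers every vertex. A graph is factorizable if it has a perfect matching, and factor-critical if the deletion of any one of its vertices leaves a factorizable graph. Let $G$ be a factorizable graph. An edge of $G$ is allowed if it lies in some perfect matching of $G$. A factor-component of $G$ is an induced subgraph $G[V(C)]$, where $C$ is a connected component of the subgraph of $G$ determined by all allowed edges. A set $X\subseteq V(G)$ is separating if every factor-component $H$ satisfies $V(H)\subseteq X$ or $V(H)\cap X=\emptyset$. For factor-components $G_1,G_2$ of $G$, write $G_1\trianglelefteq G_2$ if there is a separating set $X$ with $V(G_1)\cup V(G_2)\subseteq X$ such that $G[X]/G_1$ is factor-critical, where $G[X]/G_1$ is obtained from $G[X]$ by contracting all edges of $G[V(G_1)]$. Let $M$ be a perfect matching of $G$. A path $P\subseteq G$ is $M$-saturated if it has an odd number of edges, $E(P)\setminus M$ is a matching, and $M\cap E(P)$ is a perfect matching of $P$. An ear relative to a subgraph $H$ of $G$ is a path in $G$ whose end vertices are in $H$ while its internal vertices are not, or a circuit in $G$ exactly one vertex of which is in $H$. An $M$-ear relative to $H$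 is an ear $P$ relative to $H$ such that $P-V(H)$ is an $M$-saturated path; it is through a factor-component $H'$ if $V(P)\cap V(H')\neq\emptyset$. An $M$-ear sequence from $G_1$ to $G_2$ is a sequence $(H_0,\ldots,H_k)$, $k\ge 0$, of pairwise distinct factor-components of $G$ with $H_0=G_1$ and $H_k=G_2$ such that for each $i=1,\ldots,k$ there is an $M$-ear relative to $H_{i-1}$ and through $H_i$. **Theorem.** Let $G$ be a factorizable graph, $M$ a perfect matching of $G$, and $G_1,G_2$ factor-components of $G$. Then $G_1\trianglelefteq G_2$ if and only if there exists an $M$-ear sequence from $G_1$ to $G_2$. -/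

import Mathlib

open scoped Graph

namespace Graph

variable {α β : Type*}

/-! ### Matchings -/

/-- `M` is a matching of `G`: a set of (non-loop) edges of `G`, no two of which have a common
vertex. -/
def IsMatching (G : Graph α β) (M : Set β) : Prop :=
  M ⊆ E(G) ∧ (∀ e ∈ M, ∀ x, ¬ G.IsLoopAt e x) ∧
    ∀ e ∈ M, ∀ f ∈ M, e ≠ f → ∀ x, ¬ (G.Inc e x ∧ G.Inc f x)

/-- `M` is a perfect matching of `G`: a matching that covers every vertex. -/
def IsPerfectMatching (G : Graph α β) (M : Set β) : Prop :=
  G.IsMatching M ∧ ∀ x ∈ V(G), ∃ e ∈ M, G.Inc e x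

/-- A graph is factorizable if it has a perfect matching. -/
def IsFactorizable (G : Graph α β) : Prop :=
  ∃ M, G.IsPerfectMatching M

/-- A graph is factor-critical if deleting any single vertex leaves a factorizable graph. -/
def IsFactorCritical (G : Graph α β) : Prop :=
  ∀ x ∈ V(G), (G.deleteVerts {x}).IsFactorizable

/-! ### Connected components and contraction -/

/-- The vertices that can be reached from `x` in `G` (for `x ∈ V(G)`, the vertex set of the
connected component of `x`). -/
def reachSet (G : Graph α β) (x : α) : Set α :=
  {y | y ∈ V(G) ∧ Relation.ReflTransGen G.Adj x y}

/-- `C` is a connected component of `G`. -/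
def IsConnComponent (G C : Graph α β) : Prop :=
  ∃ x ∈ V(G), C = G.induce (G.reachSet x)

/-- The contraction `G / F` of `G` by a set `F` of edges. The edges in `F` disappear, and the
vertices of `G / F` are the classes of vertices of `G` that are joined by edges in `F`. -/
def contractEdges (G : Graph α β) (F : Set β) : Graph (Set α) β :=
  (G.deleteEdges F).map (G.restrict F).reachSet

/-- The contraction `G / X := G / E(G[X])` of `G` by a set `X` of vertices. -/
def contractVerts (G : Graph α β) (X : Set α) : Graph (Set α) β :=
  G.contractEdges E(G.induce X)

/-! ### Factor-components -/

/-- An edge is allowed if it is contained in a perfect matching. -/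
def IsAllowed (G : Graph α β) (e : β) : Prop :=
  ∃ M, G.IsPerfectMatching M ∧ e ∈ M

/-- `C` is an elementary component of the factorizable graph `G`: a connected component of the
subgraph determined by all the allowed edges. (As `G` is factorizable, every vertex is an end of
an allowed edge, so this subgraph has all the vertices of `G`.) -/
def IsElementaryComponent (G C : Graph α β) : Prop :=
  (G.restrict {e | G.IsAllowed e}).IsConnComponent C

/-- `H` is a factor-component of `G`: the subgraph of `G` induced by the vertex set of an
elementary component. -/
def IsFactorComponent (G H : Graph α β) : Prop :=
  ∃ C, G.IsElementaryComponent C ∧ H = G.induce V(C)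

/-! ### The relation between factor-components -/

/-- A set `X` of vertices is separating if each factor-component lies inside `X` or is disjoint
from `X`. -/
def IsSeparating (G : Graph α β) (X : Set α) : Prop :=
  X ⊆ V(G) ∧ ∀ H, G.IsFactorComponent H → V(H) ⊆ X ∨ Disjoint V(H) X

/-- `X` is a critical-inducing set for `G₁` to `G₂`. -/
def IsCriticalInducing (G G₁ G₂ : Graph α β) (X : Set α) : Prop :=
  G.IsSeparating X ∧ V(G₁) ∪ V(G₂) ⊆ X ∧ ((G.induce X).contractVerts V(G₁)).IsFactorCritical

/-- The relation `G₁ ⊴ G₂` between factor-components of `G`. -/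
def Yields (G G₁ G₂ : Graph α β) : Prop :=
  ∃ X, G.IsCriticalInducing G₁ G₂ X

/-! ### Paths, circuits and ears -/

/-- The vertices and edges of the graph `P` are exactly those of the sequence
`v 0, e 0, v 1, e 1, …, e (n - 1), v n`, where each `e i` joins `v i` and `v (i + 1)`. -/
def IsTracedBy (P : Graph α β) (n : ℕ) (v : ℕ → α) (e : ℕ → β) : Prop :=
  (∀ x, x ∈ V(P) ↔ ∃ i ≤ n, x = v i) ∧
    ∀ f x y, P.IsLink f x y ↔ ∃ i < n, f = e i ∧ s(x, y) = s(v i, v (i + 1))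

/-- The graph `P` is a path with end vertices `a` and `b` (for `a = b`, a path with one vertex and
no edges). -/
def IsPathBetween (P : Graph α β) (a b : α) : Prop :=
  ∃ n v e, P.IsTracedBy n v e ∧ Set.InjOn v {i | i ≤ n} ∧ v 0 = a ∧ v n = b

/-- The graph `P` is a circuit. -/
def IsCircuit (P : Graph α β) : Prop :=
  ∃ n v e, 1 ≤ n ∧ P.IsTracedBy n v e ∧ Set.InjOn v {i | i < n} ∧ Set.InjOn e {i | i < n} ∧
    v n = v 0

/-- The path or circuit `P` is `M`-alternating. -/
def IsAlternating (P : Graph α β) (M : Set β) : Prop :=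
  P.IsMatching (E(P) \ M)

/-- `P` is an `M`-saturated path. -/
def IsSaturatedPath (P : Graph α β) (M : Set β) : Prop :=
  (∃ a b, P.IsPathBetween a b) ∧ P.IsAlternating M ∧ Odd E(P).ncard ∧
    P.IsPerfectMatching (M ∩ E(P))

/-- `P` is an ear in `G` relative to `H`: a path whose end vertices are in `H` while its internal
vertices are not, or a circuit of which exactly one vertex is in `H`. -/
def IsEar (G H P : Graph α β) : Prop :=
  P ≤ G ∧ ((∃ a b, P.IsPathBetween a b ∧ V(P) ∩ V(H) = {a, b}) ∨
    (P.IsCircuit ∧ ∃ a, V(P) ∩ V(H) = {a}))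

/-- `P` is an `M`-ear in `G` relative to `H`: an ear such that `P - V(H)` is an `M`-saturated
path. -/
def IsMEar (G : Graph α β) (M : Set β) (H P : Graph α β) : Prop :=
  G.IsEar H P ∧ (P.deleteVerts V(H)).IsSaturatedPath M

/-- `(H 0, …, H k)` is an `M`-ear sequence in `G`: its members are distinct factor-components, and
for each `i < k` there is an `M`-ear relative to `H i` and through `H (i + 1)`, that is, having a
vertex of `H (i + 1)`. -/
def IsMEarSequence (G : Graph α β) (M : Set β) (k : ℕ) (H : Fin (k + 1) → Graph α β) : Prop :=
  (∀ i, G.IsFactorComponent (H i)) ∧ Function.Injective H ∧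
    ∀ i : Fin k, ∃ P, G.IsMEar M (H i.castSucc) P ∧ (V(P) ∩ V(H i.succ)).Nonempty

end Graph

/-! Write `m x` for the vertex matched with `x` by `M`, and `C` for `V(G₁)`. An alternating path is
stored as the list of matched pairs it traverses, each given by the vertex at which it is entered;
the path leaves at its mate. Vertex sets used as targets are closed under `m` wherever whole pairs
matter, so conditions on entered vertices control the pairs.

Factor-criticality of `G[X]/C` means that each `x ∈ X` has an alternating path in `X` to `C`
starting with its own matching edge (`Bal`). Such a path appears on superposing `M` with a perfect
matching of the contraction minus `x`; conversely, switching `M` along it moves the uncovered vertex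
from `C` to `x`. Thus `isCriticalInducing_iff` replaces the relation by `IsCrit`.

From ears to the relation: inside a factor-component, every vertex has such a path to every matched
pair (`IsPerfectMatching.bal_comp`). Hence a factor-component together with all those met by one of
its ears satisfies `IsCrit` (`EarList.isCrit`), and such sets compose (`IsCrit.union`).

From the relation to ears: let `U` be the union of the factor-components reachable from `G₁` by
ears. The heart is `not_earList_earReach`: no alternating ear relative to `U` exists. Continue such
an ear inside `U` from its second end towards `C` until it meets `C` or a path from its first end
`u` to `C`. Depending on the direction of this meeting, one obtains either an ear relative to a
single reached factor-component and through a vertex outside `U`, or an alternating circuit through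
the edge leaving `U` at `u`. The latter makes this edge allowed, although `U` is a union of
factor-components. Finally, a critical-inducing set not contained in `U` would contain an ear
relative to `U`: for a pair outside `U`, glue the paths to `U` leaving it in both directions
(`IsCrit.subset_earReach`). -/

namespace Graph

/-! ### Alternating sequences of matched pairs -/

section Alternating

variable {α : Type*} {A : α → α → Prop} {m : α → α} {a b x y : α} {l l₁ l₂ p : List α}
  {S T W Y : Set α}

/-- For a list `x₀, …, xₖ`, this says that `a` is related to `x₀`, each `m xᵢ` is related to
`xᵢ₊₁`, and `m xₖ` is related to `b` (for the empty list, `a` is related to `b`). -/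
def Alt (A : α → α → Prop) (m : α → α) : α → List α → α → Prop
  | a, [], b => A a b
  | a, x :: l, b => A a x ∧ Alt A m (m x) l b

/-- The pairs `{x, m x}`, for `x` in the list, are pairwise distinct. -/
def PairNodup (m : α → α) (l : List α) : Prop :=
  (l.map fun x ↦ s(x, m x)).Nodup

/-- `x` lies in `T`, or there is an alternating path in `W` that starts with the pair of `x`
and has only its last vertex in `T`. -/
def Bal (A : α → α → Prop) (m : α → α) (W T : Set α) (x : α) : Prop :=
  x ∈ T ∨ ∃ l b, Alt A m (m x) l b ∧ b ∈ T ∧ PairNodup m (x :: l) ∧ ∀ y ∈ x :: l, y ∈ W ∧ y ∉ T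

/-- The list `p` describes the interior of an alternating ear relative to `T`. -/
def EarList (A : α → α → Prop) (m : α → α) (T : Set α) (p : List α) : Prop :=
  p ≠ [] ∧ PairNodup m p ∧ (∀ x ∈ p, x ∉ T) ∧ ∃ a ∈ T, ∃ b ∈ T, Alt A m a p b

lemma alt_append : Alt A m a (l₁ ++ x :: l₂) b ↔ Alt A m a l₁ x ∧ Alt A m (m x) l₂ b := by
  induction l₁ generalizing a with
  | nil => rfl
  | cons y l ih => simp [Alt, ih, and_assoc]

lemma Alt.mono {A' : α → α → Prop} (hA : ∀ x y, A x y → A' x y) (h : Alt A m a l b) :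
    Alt A' m a l b := by
  induction l generalizing a with
  | nil => exact hA _ _ h
  | cons y l ih => exact ⟨hA _ _ h.1, ih h.2⟩

/-- Traversed backwards, each pair is entered at the vertex where it was left, hence the `map m`. -/
lemma Alt.reverse (hA : ∀ x y, A x y → A y x) (hm : ∀ x, m (m x) = x) (h : Alt A m a l b) :
    Alt A m b (l.map m).reverse a := by
  induction l generalizing a with
  | nil => exact hA _ _ h
  | cons y l ih =>
    simp only [List.map_cons, List.reverse_cons]
    exact alt_append.2 ⟨ih h.2, by rw [hm]; exact hA _ _ h.1⟩

lemma pair_eq_iff (hm : ∀ x, m (m x) = x) : s(x, m x) = s(y, m y) ↔ x = y ∨ x = m y := by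
  rw [Sym2.eq_iff]
  constructor
  · rintro (h | h)
    · exact .inl h.1
    · exact .inr h.1
  · rintro (rfl | rfl)
    · simp
    · simp [hm]

lemma pairNodup_append (hm : ∀ x, m (m x) = x) : PairNodup m (l₁ ++ l₂) ↔
    PairNodup m l₁ ∧ PairNodup m l₂ ∧ ∀ x ∈ l₁, ∀ y ∈ l₂, x ≠ y ∧ x ≠ m y := by
  have : ∀ x y, (¬ s(x, m x) = s(y, m y)) ↔ (x ≠ y ∧ x ≠ m y) := fun x y ↦ by
    rw [pair_eq_iff hm, not_or]
  simp only [PairNodup, List.map_append, List.nodup_append, List.mem_map, ne_eq,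
    forall_exists_index, and_imp, forall_apply_eq_imp_iff₂, this]

lemma pairNodup_cons (hm : ∀ x, m (m x) = x) : PairNodup m (x :: l) ↔
    PairNodup m l ∧ ∀ y ∈ l, x ≠ y ∧ x ≠ m y := by
  rw [← List.singleton_append, pairNodup_append hm]
  simp [PairNodup]

lemma PairNodup.sublist (h : PairNodup m l) (hl : l₁.Sublist l) : PairNodup m l₁ :=
  List.Nodup.sublist (hl.map _) h

lemma PairNodup.reverse (hm : ∀ x, m (m x) = x) (h : PairNodup m l) :
    PairNodup m (l.map m).reverse := by
  have : (fun x ↦ s(x, m x)) ∘ m = fun x ↦ s(x, m x) := by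
    funext x
    simp [hm, Sym2.eq_swap]
  rw [PairNodup, List.map_reverse, List.nodup_reverse, List.map_map, this]
  exact h

lemma Alt.exists_prefix (h : Alt A m a l b) (hb : b ∈ T) :
    ∃ l' b', l' <+: l ∧ Alt A m a l' b' ∧ b' ∈ T ∧ ∀ x ∈ l', x ∉ T := by
  induction l generalizing a with
  | nil => exact ⟨[], b, List.prefix_rfl, h, hb, by simp⟩
  | cons y l ih =>
    by_cases hy : y ∈ T
    · exact ⟨[], y, List.nil_prefix, h.1, hy, by simp⟩
    · obtain ⟨l', b', h1, h2, h3, h4⟩ := ih h.2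
      exact ⟨y :: l', b', List.cons_prefix_cons.2 ⟨rfl, h1⟩, ⟨h.1, h2⟩, h3, by simpa [hy] using h4⟩

lemma EarList.reverse (hA : ∀ x y, A x y → A y x) (hm : ∀ x, m (m x) = x)
    (hT : ∀ x ∈ T, m x ∈ T) (h : EarList A m T p) : EarList A m T (p.map m).reverse := by
  obtain ⟨h0, h1, h2, a, ha, b, hb, h3⟩ := h
  refine ⟨by simpa, h1.reverse hm, fun x hx hxT ↦ ?_, b, hb, a, ha, h3.reverse hA hm⟩
  simp only [List.mem_reverse, List.mem_map] at hx
  obtain ⟨y, hy, rfl⟩ := hx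
  exact h2 y hy (by simpa [hm] using hT _ hxT)

lemma Bal.mono {W' : Set α} (hW : W ⊆ W') (h : Bal A m W T x) : Bal A m W' T x :=
  h.imp id fun ⟨l, b, h1, h2, h3, h4⟩ ↦ ⟨l, b, h1, h2, h3, fun y hy ↦ ⟨hW (h4 y hy).1, (h4 y hy).2⟩⟩

lemma Bal.mono_rel {A' : α → α → Prop} (hA : ∀ x y, A x y → A' x y) (h : Bal A m W T x) :
    Bal A' m W T x :=
  h.imp id fun ⟨l, b, h1, h2⟩ ↦ ⟨l, b, h1.mono hA, h2⟩

/-- The part of an alternating path before it reaches a larger set. -/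
lemma Bal.superset (hYT : Y ⊆ T) (h : Bal A m W Y x) : Bal A m W T x := by
  by_cases hx : x ∈ T
  · exact .inl hx
  obtain h | ⟨l, b, h1, h2, h3, h4⟩ := h
  · exact .inl (hYT h)
  obtain ⟨l', b', g1, g2, g3, g4⟩ := h1.exists_prefix (hYT h2)
  refine .inr ⟨l', b', g2, g3, h3.sublist (g1.sublist.cons_cons x), fun y hy ↦ ⟨(h4 y ?_).1, ?_⟩⟩
  · exact (g1.sublist.cons_cons x).subset hy
  · obtain rfl | hy := List.mem_cons.1 hy
    exacts [hx, g4 y hy]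

/-- The first path stays outside `T` before its end and its continuation stays inside, so the two
share no pair and can simply be concatenated. -/
lemma Bal.trans (hm : ∀ x, m (m x) = x) (hT : ∀ x ∈ T, m x ∈ T) (hYT : Y ⊆ T) (hTW : T ⊆ W)
    (h : Bal A m W T x) (hb : ∀ b ∈ T, Bal A m T Y b) : Bal A m W Y x := by
  obtain h | ⟨l, b, h1, h2, h3, h4⟩ := h
  · exact (hb x h).mono hTW
  obtain h | ⟨l', c, g1, g2, g3, g4⟩ := hb b h2
  · exact .inr ⟨l, b, h1, h, h3, fun y hy ↦ ⟨(h4 y hy).1, fun hY ↦ (h4 y hy).2 (hYT hY)⟩⟩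
  refine .inr ⟨l ++ b :: l', c, alt_append.2 ⟨h1, g1⟩, g2, ?_, fun y hy ↦ ?_⟩
  · rw [← List.cons_append, pairNodup_append hm]
    refine ⟨h3, g3, fun y hy z hz ↦ ⟨?_, ?_⟩⟩
    · rintro rfl
      exact (h4 y hy).2 (g4 y hz).1
    · rintro rfl
      exact (h4 _ hy).2 (hT _ (g4 z hz).1)
  · rw [← List.cons_append, List.mem_append] at hy
    obtain hy | hy := hy
    · exact ⟨(h4 y hy).1, fun hY ↦ (h4 y hy).2 (hYT hY)⟩
    · exact ⟨hTW (g4 y hy).1, (g4 y hy).2⟩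

lemma Alt.exists_last (h : Alt A m (m x) l b) : ∃ d ∈ x :: l, A (m d) b := by
  induction l generalizing x with
  | nil => exact ⟨x, by simp, h⟩
  | cons y l ih =>
    obtain ⟨d, hd, hdb⟩ := ih h.2
    exact ⟨d, List.mem_cons_of_mem _ hd, hdb⟩

lemma Alt.exists_prev (h : Alt A m (m x) l b) (hy : y ∈ l) : ∃ d ∈ x :: l, A (m d) y := by
  obtain ⟨l₁, l₂, rfl⟩ := List.append_of_mem hy
  obtain ⟨d, hd, hdy⟩ := (alt_append.1 h).1.exists_last
  exact ⟨d, by simp at hd ⊢; tauto, hdy⟩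

lemma Alt.exists_next (h : Alt A m (m x) l b) (hy : y ∈ x :: l) :
    ∃ d, A (m y) d ∧ (d ∈ l ∨ d = b) := by
  induction l generalizing x with
  | nil =>
    obtain rfl : y = x := by simpa using hy
    exact ⟨b, h, .inr rfl⟩
  | cons z l ih =>
    obtain rfl | hy := List.mem_cons.1 hy
    · exact ⟨z, h.1, by simp⟩
    · obtain ⟨d, h1, h2⟩ := ih h.2 hy
      exact ⟨d, h1, h2.imp_left (List.mem_cons_of_mem _)⟩

/-- If the links of an alternating path belong to a matching, the next vertex cannot belong to the
pair of a vertex of the path, unless it is the first vertex. -/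
lemma Alt.eq_head_of_mem_pair {r : α → α → Prop} (hm : ∀ x, m (m x) = x)
    (hr : ∀ x y, r x y → r y x) (hfun : ∀ x ∉ Y, ∀ y z, r x y → r x z → y = z)
    (hirr : ∀ x, ¬ r x x) (hY : ∀ x ∈ Y, m x ∈ Y) {z c : α} (hne : ∀ x ∈ z :: l, m x ≠ x)
    (h : Alt r m (m z) l b) (hnd : PairNodup m (z :: l)) (hl : ∀ x ∈ z :: l, x ∉ Y)
    (hc : c ∈ z :: l) (hbc : b = c ∨ b = m c) : b = z := by
  have hY' : ∀ x ∉ Y, m x ∉ Y := fun x hx h ↦ hx (by simpa [hm] using hY _ h)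
  induction l generalizing z with
  | nil =>
    obtain rfl : c = z := by simpa using hc
    obtain rfl | rfl := hbc
    · rfl
    · exact (hirr _ h).elim
  | cons y l ih =>
    obtain ⟨h1, h2⟩ := pairNodup_cons hm |>.1 hnd
    obtain rfl | hc := List.mem_cons.1 hc
    · obtain rfl | rfl := hbc
      · rfl
      · obtain ⟨d, hd, hdb⟩ := Alt.exists_last h.2
        -- Here `b` is the mate of the first vertex, so the link into `b` and the first link of the
        -- path share an end; uniqueness forces a repeated pair.
        have h3 : y = m d := hfun _ (hY' _ (hl _ (by simp))) _ _ h.1 (hr _ _ hdb)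
        obtain rfl | hdl := List.mem_cons.1 hd
        · exact (hne d (by simp) h3.symm).elim
        · exact ((pairNodup_cons hm |>.1 h1).2 d hdl).2 h3 |>.elim
    · have h3 := ih (fun x hx ↦ hne x (List.mem_cons_of_mem _ hx)) h.2 h1
        (fun x hx ↦ hl x (List.mem_cons_of_mem _ hx)) hc
      obtain ⟨d, hd, hdb⟩ := Alt.exists_last h.2
      rw [h3] at hdb
      have h4 : m d = m z :=
        hfun y (hl y (by simp)) _ _ (hr _ _ hdb) (hr _ _ h.1)
      have h5 : d = z := by rw [← hm d, h4, hm]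
      exact ((h2 d hd).1 h5.symm).elim

/-- An alternating path that can be extended until it reaches `Y` does reach `Y`. -/
lemma exists_alt_of_forall_extend {r : α → α → Prop} {z : α} (hm : ∀ x, m (m x) = x)
    (hW : W.Finite) (hz : z ∈ W) (hzY : z ∉ Y) (h0 : ∃ b, r (m z) b)
    (hext : ∀ l b, Alt r m (m z) l b → PairNodup m (z :: l) → (∀ y ∈ z :: l, y ∈ W ∧ y ∉ Y) →
      b ∉ Y → (∀ c ∈ z :: l, b ≠ c ∧ b ≠ m c) ∧ b ∈ W ∧ ∃ b', r (m b) b') :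
    Bal r m W Y z := by
  by_contra hcon
  -- If `Y` were never met, the extension could be repeated to any length, exceeding the size of
  -- `W`.
  have key : ∀ n : ℕ, ∃ l b, l.length = n ∧ Alt r m (m z) l b ∧ PairNodup m (z :: l) ∧
      ∀ y ∈ z :: l, y ∈ W ∧ y ∉ Y := by
    intro n
    induction n with
    | zero =>
      obtain ⟨b, hb⟩ := h0
      exact ⟨[], b, rfl, hb, by simp [PairNodup], by simp [hz, hzY]⟩
    | succ n ih =>
      obtain ⟨l, b, hn, h1, h2, h3⟩ := ih
      have hbY : b ∉ Y := fun hb ↦ hcon (.inr ⟨l, b, h1, hb, h2, h3⟩)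
      obtain ⟨h4, h5, b', h6⟩ := hext l b h1 h2 h3 hbY
      refine ⟨l ++ [b], b', by simp [hn], alt_append.2 ⟨h1, h6⟩, ?_, ?_⟩
      · rw [← List.cons_append, pairNodup_append hm]
        refine ⟨h2, by simp [PairNodup], fun x hx y hy ↦ ?_⟩
        obtain rfl : y = b := by simpa using hy
        refine ⟨(h4 x hx).1.symm, fun h ↦ (h4 x hx).2 ?_⟩
        rw [h, hm]
      · intro y hy
        rw [← List.cons_append, List.mem_append, List.mem_singleton] at hy
        obtain hy | rfl := hy
        exacts [h3 y hy, ⟨h5, hbY⟩]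
  obtain ⟨l, b, hn, -, h2, h3⟩ := key W.ncard
  have hnd : (z :: l).Nodup := List.Nodup.of_map _ h2
  classical
  have h4 : ((z :: l).toFinset : Set α) ⊆ W := fun y hy ↦ (h3 y (by simpa using hy)).1
  have h5 := Set.ncard_le_ncard h4 hW
  rw [Set.ncard_coe_finset, List.toFinset_card_of_nodup hnd] at h5
  simp [hn] at h5

end Alternating

/-! ### Perfect matchings and the involution they induce -/

section Matching

variable {α β : Type*} {G : Graph α β} {M N : Set β} {S : Set α} {a b x y r : α} {e f : β}
  {m : α → α}

lemma isPerfectMatching_deleteVerts_iff : (G.deleteVerts S).IsPerfectMatching N ↔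
    (∀ e ∈ N, ∃ u v, u ≠ v ∧ u ∉ S ∧ v ∉ S ∧ G.IsLink e u v) ∧
    (∀ x ∈ V(G), x ∉ S → ∃ e ∈ N, G.Inc e x) ∧
    ∀ e ∈ N, ∀ f ∈ N, ∀ x, G.Inc e x → G.Inc f x → e = f := by
  have hinc : ∀ e, (∃ u v, u ≠ v ∧ u ∉ S ∧ v ∉ S ∧ G.IsLink e u v) → ∀ x, G.Inc e x →
      (G.deleteVerts S).Inc e x := by
    rintro e ⟨u, v, -, hu, hv, he⟩ x ⟨y, hy⟩
    refine ⟨y, (deleteVerts_isLink ..).2 ⟨hy, ?_, ?_⟩⟩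
    · obtain rfl | rfl := hy.left_eq_or_eq he <;> assumption
    · obtain rfl | rfl := hy.right_eq_or_eq he <;> assumption
  constructor
  · rintro ⟨⟨h1, h2, h3⟩, h4⟩
    have h0 : ∀ e ∈ N, ∃ u v, u ≠ v ∧ u ∉ S ∧ v ∉ S ∧ G.IsLink e u v := by
      intro e he
      obtain ⟨u, v, huv⟩ := exists_isLink_of_mem_edgeSet (h1 he)
      refine ⟨u, v, ?_, ?_⟩
      · rintro rfl
        exact h2 e he u huv
      · obtain ⟨g1, g2, g3⟩ := (deleteVerts_isLink ..).1 huv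
        exact ⟨g2, g3, g1⟩
    refine ⟨h0, fun x hx hxS ↦ ?_, fun e he f hf x hex hfx ↦ ?_⟩
    · obtain ⟨e, he, hex⟩ := h4 x (by simp [hx, hxS])
      exact ⟨e, he, hex.mono deleteVerts_le⟩
    · by_contra hne
      exact h3 e he f hf hne x ⟨hinc e (h0 e he) x hex, hinc f (h0 f hf) x hfx⟩
  · rintro ⟨h1, h2, h3⟩
    refine ⟨⟨fun e he ↦ ?_, fun e he x hx ↦ ?_, fun e he f hf hne x hx ↦ ?_⟩, fun x hx ↦ ?_⟩
    · obtain ⟨u, v, -, hu, hv, huv⟩ := h1 e he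
      exact ((deleteVerts_isLink ..).2 ⟨huv, hu, hv⟩).edge_mem
    · obtain ⟨u, v, hne, hu, hv, huv⟩ := h1 e he
      have hx' : G.IsLink e x x := ((deleteVerts_isLink ..).1 hx).1
      obtain ⟨rfl, rfl⟩ | ⟨rfl, rfl⟩ := hx'.eq_and_eq_or_eq_and_eq huv <;> exact hne rfl
    · exact hne (h3 e he f hf x (hx.1.mono deleteVerts_le) (hx.2.mono deleteVerts_le))
    · rw [vertexSet_deleteVerts] at hx
      obtain ⟨e, he, hex⟩ := h2 x hx.1 hx.2
      exact ⟨e, he, hinc e (h1 e he) x hex⟩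

lemma isPerfectMatching_iff : G.IsPerfectMatching N ↔
    (∀ e ∈ N, ∃ u v, u ≠ v ∧ G.IsLink e u v) ∧ (∀ x ∈ V(G), ∃ e ∈ N, G.Inc e x) ∧
    ∀ e ∈ N, ∀ f ∈ N, ∀ x, G.Inc e x → G.Inc f x → e = f := by
  have h := isPerfectMatching_deleteVerts_iff (G := G) (N := N) (S := ∅)
  simpa using h

/-- The involution `m` maps each vertex to the vertex it is matched with by `M`. -/
structure IsMate (G : Graph α β) (M : Set β) (m : α → α) : Prop where
  invol : ∀ x, m (m x) = x
  exists_isLink : ∀ x ∈ V(G), ∃ e ∈ M, G.IsLink e x (m x)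
  eq_of_isLink : ∀ e ∈ M, ∀ x y, G.IsLink e x y → m x = y
  ne : ∀ x ∈ V(G), m x ≠ x

lemma IsPerfectMatching.exists_isMate (hM : G.IsPerfectMatching M) : ∃ m, G.IsMate M m := by
  classical
  obtain ⟨h1, h2, h3⟩ := isPerfectMatching_iff.1 hM
  have hfun : ∀ x y z, (∃ e ∈ M, G.IsLink e x y) → (∃ e ∈ M, G.IsLink e x z) → y = z := by
    rintro x y z ⟨e, he, hey⟩ ⟨f, hf, hfz⟩
    obtain rfl := h3 e he f hf x hey.inc_left hfz.inc_left
    exact hey.right_unique hfz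
  -- The default value `x` makes `m` an involution on the whole type, not only on `V(G)`.
  let m : α → α := fun x ↦ if h : ∃ y, ∃ e ∈ M, G.IsLink e x y then h.choose else x
  have hm : ∀ x y, (∃ e ∈ M, G.IsLink e x y) → m x = y := by
    intro x y h
    have h' : ∃ y, ∃ e ∈ M, G.IsLink e x y := ⟨y, h⟩
    have : m x = h'.choose := by simp only [m]; rw [dif_pos h']
    rw [this]
    exact hfun x _ _ h'.choose_spec h
  have hex : ∀ x ∈ V(G), ∃ e ∈ M, G.IsLink e x (m x) := by
    intro x hx
    obtain ⟨e, he, y, hy⟩ := h2 x hx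
    rw [hm x y ⟨e, he, hy⟩]
    exact ⟨e, he, hy⟩
  refine ⟨m, fun x ↦ ?_, hex, fun e he x y h ↦ hm x y ⟨e, he, h⟩, fun x hx h ↦ ?_⟩
  · by_cases hx : x ∈ V(G)
    · obtain ⟨e, he, h⟩ := hex x hx
      exact hm _ _ ⟨e, he, h.symm⟩
    · have : m x = x := by
        simp only [m]
        rw [dif_neg]
        rintro ⟨y, e, -, h⟩
        exact hx h.left_mem
      rw [this, this]
  · obtain ⟨e, he, h'⟩ := hex x hx
    rw [h] at h'
    exact hM.1.2.1 e he x h'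

lemma IsMate.mem (hm : G.IsMate M m) (hx : x ∈ V(G)) : m x ∈ V(G) := by
  obtain ⟨e, -, h⟩ := hm.exists_isLink x hx
  exact h.right_mem

/-- Exchanging two consecutive edges moves the uncovered vertex. -/
lemma IsPerfectMatching.switch (hN : (G.deleteVerts (insert y S)).IsPerfectMatching N)
    (he : e ∈ N) (hab : G.IsLink e a b) (hby : G.IsLink f b y) (hyS : y ∉ S) :
    (G.deleteVerts (insert a S)).IsPerfectMatching (insert f (N \ {e})) := by
  rw [isPerfectMatching_deleteVerts_iff] at hN ⊢
  obtain ⟨h1, h2, h3⟩ := hN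
  have hne : ∀ g ∈ N, ∀ x, G.Inc g x → x ≠ y ∧ x ∉ S := by
    intro g hg x hx
    obtain ⟨u, v, -, hu, hv, huv⟩ := h1 g hg
    simp only [Set.mem_insert_iff, not_or] at hu hv
    obtain rfl | rfl := hx.eq_or_eq_of_isLink huv
    exacts [hu, hv]
  have habne : a ≠ b := by
    rintro rfl
    obtain ⟨u, v, huv', hu, hv, huv⟩ := h1 e he
    obtain ⟨rfl, rfl⟩ | ⟨rfl, rfl⟩ := hab.eq_and_eq_or_eq_and_eq huv <;> exact huv' rfl
  have hay := hne e he a hab.inc_left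
  have hb := hne e he b hab.inc_right
  have hab' : ∀ g ∈ N \ {e}, ∀ x, G.Inc g x → x ≠ a ∧ x ≠ b := by
    intro g hg x hx
    constructor
    · rintro rfl
      exact hg.2 (h3 g hg.1 e he x hx hab.inc_left)
    · rintro rfl
      exact hg.2 (h3 g hg.1 e he x hx hab.inc_right)
  have hfx : ∀ x, G.Inc f x → x = b ∨ x = y := fun x hx ↦ hx.eq_or_eq_of_isLink hby
  refine ⟨fun g hg ↦ ?_, fun x hx hxS ↦ ?_, ?_⟩
  · obtain rfl | hg := hg
    · refine ⟨b, y, hb.1, ?_, ?_, hby⟩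
      · simp [hb.2, habne.symm]
      · simp [hyS, hay.1.symm]
    · obtain ⟨u, v, huv', hu, hv, huv⟩ := h1 g hg.1
      have hu' := (hab' g hg u huv.inc_left).1
      have hv' := (hab' g hg v huv.inc_right).1
      simp only [Set.mem_insert_iff, not_or] at hu hv ⊢
      exact ⟨u, v, huv', ⟨hu', hu.2⟩, ⟨hv', hv.2⟩, huv⟩
  · simp only [Set.mem_insert_iff, not_or] at hxS
    by_cases hxb : x = b
    · exact ⟨f, by simp, hxb ▸ hby.inc_left⟩
    by_cases hxy : x = y
    · exact ⟨f, by simp, hxy ▸ hby.inc_right⟩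
    obtain ⟨g, hg, hgx⟩ := h2 x hx (by simp [hxy, hxS.2])
    refine ⟨g, .inr ⟨hg, ?_⟩, hgx⟩
    rintro rfl
    obtain rfl | rfl := hgx.eq_or_eq_of_isLink hab
    exacts [hxS.1 rfl, hxb rfl]
  · have hcross : ∀ g ∈ N \ {e}, ∀ x, G.Inc f x → G.Inc g x → False := by
      intro g hg x hx hgx
      obtain rfl | rfl := hfx x hx
      exacts [(hab' g hg x hgx).2 rfl, (hne g hg.1 x hgx).1 rfl]
    rintro g (rfl | hg) g' (rfl | hg') x hx hx'
    · rfl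
    · exact (hcross g' hg' x hx hx').elim
    · exact (hcross g hg x hx' hx).elim
    · exact h3 g hg.1 g' hg'.1 x hx hx'

/-- Switching along an alternating path moves the uncovered vertex from its end to its start. -/
lemma IsPerfectMatching.exists_of_alt (hm : ∀ x, m (m x) = x)
    (hN : (G.deleteVerts (insert r S)).IsPerfectMatching N) (hr : r ∉ S) {l : List α}
    (h : Alt G.Adj m (m x) l r) (hnd : PairNodup m (x :: l))
    (hl : ∀ y ∈ x :: l, ∃ e ∈ N, G.IsLink e y (m y)) :
    ∃ N', (G.deleteVerts (insert x S)).IsPerfectMatching N' ∧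
      ∀ e ∈ N, (∀ y ∈ x :: l, ¬ G.Inc e y) → e ∈ N' := by
  induction l generalizing x with
  | nil =>
    obtain ⟨e, he, hx⟩ := hl x (by simp)
    obtain ⟨f, hf⟩ := h
    refine ⟨_, hN.switch he hx hf hr, fun g hg hgx ↦ .inr ⟨hg, ?_⟩⟩
    rintro rfl
    exact hgx x (by simp) hx.inc_left
  | cons z l ih =>
    obtain ⟨hnd', hne⟩ := (pairNodup_cons hm).1 hnd
    -- Switching begins at the far end: the uncovered vertex moves from `r` to `z`, while the
    -- matching edge at `x` is untouched and available for the last exchange.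
    obtain ⟨N', hN', hsub⟩ := ih h.2 hnd' fun y hy ↦ hl y (List.mem_cons_of_mem _ hy)
    obtain ⟨e, he, hx⟩ := hl x (by simp)
    obtain ⟨f, hf⟩ := h.1
    have he' : e ∈ N' := by
      refine hsub e he fun y hy hey ↦ ?_
      obtain rfl | rfl := hey.eq_or_eq_of_isLink hx
      · exact (hne _ hy).1 rfl
      · exact (hne _ hy).2 (hm _).symm
    have hz : z ∉ S := by
      obtain ⟨g, hg, hgz⟩ := hl z (by simp)
      obtain ⟨u, v, -, hu, hv, huv⟩ := (isPerfectMatching_deleteVerts_iff.1 hN).1 g hg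
      simp only [Set.mem_insert_iff, not_or] at hu hv
      obtain rfl | rfl := hgz.inc_left.eq_or_eq_of_isLink huv
      exacts [hu.2, hv.2]
    refine ⟨_, hN'.switch he' hx hf hz, fun g hg hgx ↦ .inr ⟨hsub g hg fun y hy ↦ ?_, ?_⟩⟩
    · exact hgx y (List.mem_cons_of_mem _ hy)
    · rintro rfl
      exact hgx x (by simp) hx.inc_left

/-- The unmatched edges of an alternating circuit are allowed. -/
lemma IsPerfectMatching.isAllowed_of_alt (hM : G.IsPerfectMatching M) (hm : G.IsMate M m)
    {l : List α} (h : Alt G.Adj m (m x) l r) (hnd : PairNodup m (r :: x :: l))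
    (hl : ∀ y ∈ r :: x :: l, y ∈ V(G)) (hf : G.IsLink f x (m r)) : G.IsAllowed f := by
  obtain ⟨e, he, her⟩ := hm.exists_isLink r (hl r (by simp))
  obtain ⟨hnd', hne⟩ := (pairNodup_cons hm.invol).1 hnd
  obtain ⟨h1, h2, h3⟩ := isPerfectMatching_iff.1 hM
  have hrne := hm.ne r (hl r (by simp))
  -- The matching edge of `r` is removed and `m r` stays deleted throughout. Switching moves the
  -- other uncovered vertex from `r` to `x`, and then `f` covers both `x` and `m r`.
  have hN : (G.deleteVerts (insert r {m r})).IsPerfectMatching (M \ {e}) := by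
    refine isPerfectMatching_deleteVerts_iff.2 ⟨fun g hg ↦ ?_, fun y hy hyS ↦ ?_,
      fun g hg g' hg' ↦ h3 g hg.1 g' hg'.1⟩
    · obtain ⟨u, v, huv', huv⟩ := h1 g hg.1
      have : ∀ w, G.Inc g w → w ∉ ({r, m r} : Set α) := by
        rintro w hw (rfl | rfl)
        · exact hg.2 (h3 g hg.1 e he _ hw her.inc_left)
        · exact hg.2 (h3 g hg.1 e he _ hw her.inc_right)
      exact ⟨u, v, huv', this u huv.inc_left, this v huv.inc_right, huv⟩
    · obtain ⟨g, hg, hgy⟩ := h2 y hy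
      refine ⟨g, ⟨hg, ?_⟩, hgy⟩
      rintro rfl
      exact hyS (hgy.eq_or_eq_of_isLink her)
  obtain ⟨N, hN', -⟩ := hN.exists_of_alt hm.invol (by simpa using hrne.symm) h hnd' fun y hy ↦ by
    obtain ⟨g, hg, hgy⟩ := hm.exists_isLink y (hl y (List.mem_cons_of_mem _ hy))
    refine ⟨g, ⟨hg, ?_⟩, hgy⟩
    rintro rfl
    obtain rfl | rfl := hgy.left_eq_or_eq her
    · exact (hne _ hy).1 rfl
    · exact (hne _ hy).2 (hm.invol _).symm
  obtain ⟨g1, g2, g3⟩ := isPerfectMatching_deleteVerts_iff.1 hN'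
  have hxr : x ≠ m r := by
    rintro rfl
    exact (hne (m r) (by simp)).2 (hm.invol _).symm
  have hcross : ∀ g ∈ N, ∀ y, G.Inc g y → G.Inc f y → False := by
    intro g hg y hgy hfy
    obtain ⟨u, v, -, hu, hv, huv⟩ := g1 g hg
    obtain rfl | rfl := hgy.eq_or_eq_of_isLink huv
    · exact hu (hfy.eq_or_eq_of_isLink hf)
    · exact hv (hfy.eq_or_eq_of_isLink hf)
  refine ⟨insert f N, isPerfectMatching_iff.2 ⟨?_, fun y hy ↦ ?_, ?_⟩, by simp⟩
  · rintro g (rfl | hg)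
    · exact ⟨x, m r, hxr, hf⟩
    · obtain ⟨u, v, huv', -, -, huv⟩ := g1 g hg
      exact ⟨u, v, huv', huv⟩
  · by_cases hyS : y ∈ ({x, m r} : Set α)
    · obtain rfl | rfl := hyS
      exacts [⟨f, by simp, hf.inc_left⟩, ⟨f, by simp, hf.inc_right⟩]
    · obtain ⟨g, hg, hgy⟩ := g2 y hy hyS
      exact ⟨g, .inr hg, hgy⟩
  · rintro g (rfl | hg) g' (rfl | hg') y hy hy'
    · rfl
    · exact (hcross g' hg' y hy' hy).elim
    · exact (hcross g hg y hy hy').elim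
    · exact g3 g hg g' hg' y hy hy'

end Matching

/-! ### Factor-components -/

section Component

variable {α β : Type*} {G H : Graph α β} {M : Set β} {u v x y z : α} {e : β} {m : α → α}

/-- The vertex set of the factor-component of `x`. -/
def comp (G : Graph α β) (x : α) : Set α :=
  (G.restrict {e | G.IsAllowed e}).reachSet x

lemma comp_subset : G.comp x ⊆ V(G) := fun _ hy ↦ hy.1

lemma mem_comp_self (hx : x ∈ V(G)) : x ∈ G.comp x := ⟨hx, .refl⟩

lemma comp_eq (hy : y ∈ G.comp x) : G.comp y = G.comp x := by
  have hsymm : ∀ {a b}, Relation.ReflTransGen (G.restrict {e | G.IsAllowed e}).Adj a b →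
      Relation.ReflTransGen (G.restrict {e | G.IsAllowed e}).Adj b a := fun h ↦
    Relation.ReflTransGen.stdSymm.symm _ _ h
  ext z
  exact ⟨fun h ↦ ⟨h.1, hy.2.trans h.2⟩, fun h ↦ ⟨h.1, (hsymm hy.2).trans h.2⟩⟩

lemma IsAllowed.mem_comp (he : G.IsAllowed e) (h : G.IsLink e y z) (hy : y ∈ G.comp x) :
    z ∈ G.comp x :=
  ⟨h.right_mem, hy.2.tail ⟨e, he, h⟩⟩

lemma IsMate.mem_comp (hm : G.IsMate M m) (hM : G.IsPerfectMatching M) (hy : y ∈ G.comp x) :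
    m y ∈ G.comp x := by
  obtain ⟨e, he, h⟩ := hm.exists_isLink y hy.1
  exact IsAllowed.mem_comp ⟨M, hM, he⟩ h hy

lemma isFactorComponent_iff : G.IsFactorComponent H ↔ ∃ x ∈ V(G), H = G.induce (G.comp x) := by
  constructor
  · rintro ⟨C, ⟨x, hx, rfl⟩, rfl⟩
    exact ⟨x, hx, rfl⟩
  · rintro ⟨x, hx, rfl⟩
    exact ⟨_, ⟨x, hx, rfl⟩, rfl⟩

lemma isFactorComponent_induce_comp (hx : x ∈ V(G)) : G.IsFactorComponent (G.induce (G.comp x)) :=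
  isFactorComponent_iff.2 ⟨x, hx, rfl⟩

lemma IsFactorComponent.eq_induce_comp (hH : G.IsFactorComponent H) (hx : x ∈ V(H)) :
    H = G.induce (G.comp x) := by
  obtain ⟨y, hy, rfl⟩ := isFactorComponent_iff.1 hH
  rw [comp_eq (show x ∈ G.comp y from hx)]

lemma isSeparating_iff {X : Set α} :
    G.IsSeparating X ↔ X ⊆ V(G) ∧ ∀ x ∈ X, G.comp x ⊆ X := by
  refine and_congr_right fun hX ↦ ⟨fun h x hx ↦ ?_, fun h H hH ↦ ?_⟩
  · refine (h _ (isFactorComponent_induce_comp (hX hx))).resolve_right fun hd ↦ ?_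
    exact Set.disjoint_left.1 hd (mem_comp_self (hX hx)) hx
  · by_cases hd : Disjoint V(H) X
    · exact .inr hd
    · obtain ⟨x, hxH, hx⟩ := Set.not_disjoint_iff.1 hd
      rw [hH.eq_induce_comp hxH]
      exact .inl (h x hx)

/-- Each vertex of a factor-component is met by an alternating path that starts at a given vertex
with its matching edge and stays in the factor-component. -/
lemma IsPerfectMatching.bal_comp (hM : G.IsPerfectMatching M) (hm : G.IsMate M m)
    (hV : V(G).Finite) (hv : v ∈ G.comp u) :
    Bal G.Adj m (G.comp u) {v, m v} u := by
  obtain ⟨-, hv⟩ := hv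
  induction hv with
  | refl => exact .inl (by simp)
  | @tail v y huv hvy ih =>
  obtain ⟨e, ⟨M', hM', he⟩, hvy⟩ := hvy
  have hvu : v ∈ G.comp u := ⟨hvy.left_mem, huv⟩
  let r : α → α → Prop := fun a b ↦ ∃ e ∈ M', G.IsLink e a b
  have hrsymm : ∀ a b, r a b → r b a := fun a b ⟨e, he, h⟩ ↦ ⟨e, he, h.symm⟩
  obtain ⟨-, g2, g3⟩ := isPerfectMatching_iff.1 hM'
  have hrfun : ∀ a b c, r a b → r a c → b = c := by
    rintro a b c ⟨e, he, h⟩ ⟨f, hf, h'⟩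
    obtain rfl := g3 e he f hf a h.inc_left h'.inc_left
    exact h.right_unique h'
  have hrirr : ∀ a, ¬ r a a := fun a ⟨e, he, h⟩ ↦ hM'.1.2.1 e he a h
  let R : α → α → Prop := fun a b ↦ b = m a ∨ r a b
  have hRsymm : Std.Symm R := by
    constructor
    rintro a b (rfl | h)
    · exact .inl (hm.invol a).symm
    · exact .inr (hrsymm _ _ h)
  -- The alternating circuit of `M` and `M'` through `v`, or a single edge common to both. It
  -- contains `y`, so a path to `v` may be cut where it first meets `O` and continued around `O` to
  -- the pair of `y`.
  let O : Set α := {w | Relation.ReflTransGen R v w}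
  have hmO : ∀ w ∈ O, m w ∈ O := fun w hw ↦ Relation.ReflTransGen.tail hw (.inl rfl)
  have hrO : ∀ w ∈ O, ∀ w', r w w' → w' ∈ O := fun w hw w' h ↦
    Relation.ReflTransGen.tail hw (.inr h)
  have hvO : v ∈ O := Relation.ReflTransGen.refl
  have hOu : O ⊆ G.comp u := by
    intro w hw
    induction hw with
    | refl => exact hvu
    | tail _ h ih =>
      obtain rfl | ⟨f, hf, h⟩ := h
      · exact hm.mem_comp hM ih
      · exact IsAllowed.mem_comp ⟨M', hM', hf⟩ h ih
  have hOV : O ⊆ V(G) := hOu.trans comp_subset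
  refine (ih.superset (T := O) ?_).trans hm.invol hmO ?_ hOu fun z hz ↦ ?_
  · rintro w (rfl | rfl)
    exacts [hvO, hmO _ hvO]
  · rintro w (rfl | rfl)
    exacts [hrO v hvO _ ⟨e, he, hvy⟩, hmO _ (hrO v hvO _ ⟨e, he, hvy⟩)]
  by_cases hzY : z ∈ ({y, m y} : Set α)
  · exact .inl hzY
  refine Bal.mono_rel (A := r) (fun a b ⟨e, _, h⟩ ↦ ⟨e, h⟩) ?_
  have hnext : ∀ w ∈ O, ∃ b, r w b := by
    intro w hw
    obtain ⟨f, hf, b, h⟩ := g2 w (hOV hw)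
    exact ⟨b, f, hf, h⟩
  have hYm : ∀ x ∈ ({y, m y} : Set α), m x ∈ ({y, m y} : Set α) := by
    rintro x (rfl | rfl) <;> simp [hm.invol]
  refine exists_alt_of_forall_extend hm.invol (hV.subset hOV) hz hzY (hnext _ (hmO z hz)) ?_
  intro l b h1 h2 h3 hbY
  have hb : b ∈ O := by
    obtain ⟨d, hd, hdb⟩ := h1.exists_last
    exact hrO _ (hmO _ (h3 d hd).1) _ hdb
  refine ⟨?_, hb, hnext _ (hmO b hb)⟩
  by_contra! hcon
  obtain ⟨c, hc, hbc⟩ := hcon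
  have hbz : b = z := h1.eq_head_of_mem_pair hm.invol hrsymm (fun a _ ↦ hrfun a) hrirr hYm
    (fun x hx ↦ hm.ne x (hOV (h3 x hx).1)) h2 (fun x hx ↦ (h3 x hx).2) hc
    (by by_cases h : b = c; exacts [.inl h, .inr (hbc h)])
  -- If the walk returned to its start before meeting the pair of `y`, its pairs would be closed
  -- under both matchings and so exhaust `O`, which contains `y`.
  have hclosed : ∀ w, Relation.ReflTransGen R z w → w ∈ z :: l ∨ m w ∈ z :: l := by
    intro w hw
    induction hw with
    | refl => simp
    | @tail w w' _ h ih =>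
      obtain rfl | h := h
      · rw [hm.invol]
        exact ih.symm
      · obtain hw | hw := ih
        · have : ∃ d ∈ z :: l, r (m d) w := by
            obtain rfl | hw := List.mem_cons.1 hw
            · exact hbz ▸ h1.exists_last
            · exact h1.exists_prev hw
          obtain ⟨d, hd, hdw⟩ := this
          obtain rfl := hrfun _ _ _ h (hrsymm _ _ hdw)
          right
          rwa [hm.invol]
        · obtain ⟨d, h', hd⟩ := h1.exists_next hw
          rw [hm.invol] at h'
          obtain rfl := hrfun _ _ _ h h'
          left
          obtain hd | rfl := hd
          · exact List.mem_cons_of_mem _ hd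
          · simp [hbz]
  have hzy : Relation.ReflTransGen R z y :=
    (Relation.ReflTransGen.stdSymm.symm _ _ hz).tail (.inr ⟨e, he, hvy⟩)
  obtain h | h := hclosed y hzy
  · exact (h3 _ h).2 (by simp)
  · exact (h3 _ h).2 (by simp)

end Component

/-! ### Contraction of a factor-component -/

section Contraction

variable {α β : Type*} {G : Graph α β} {M : Set β} {c x y : α} {e : β} {m : α → α}
  {C X : Set α}

/-- `K` is the graph obtained from `G[X]` by contracting `G[C]` to the single vertex `C`, where
`φ` maps the vertices in `X` to those of `K`. -/
structure IsContraction (G : Graph α β) (X C : Set α) (K : Graph (Set α) β) (φ : α → Set α) :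
    Prop where
  vertexSet_eq : V(K) = φ '' X
  isLink_iff : ∀ e s t, K.IsLink e s t ↔
    ∃ x y, G.IsLink e x y ∧ x ∈ X ∧ y ∈ X ∧ ¬ (x ∈ C ∧ y ∈ C) ∧ φ x = s ∧ φ y = t
  of_mem : ∀ x ∈ C, φ x = C
  of_notMem : ∀ x ∈ X, x ∉ C → φ x = {x}

/-- Allowed edges meeting a factor-component have both ends in it, so they lie in `G[X]` and are
among the contracted edges; they connect the whole component. -/
lemma reachSet_eq_of_comp (hcX : G.comp c ⊆ X) (hx : x ∈ G.comp c) :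
    ((G.induce X).restrict E((G.induce X).induce (G.comp c))).reachSet x = G.comp c := by
  ext y
  constructor
  · rintro ⟨-, h⟩
    induction h with
    | refl => exact hx
    | tail _ h _ =>
      obtain ⟨e, ⟨⟨u, v, huv⟩, h⟩⟩ := h
      obtain rfl | rfl := h.1.right_eq_or_eq huv.1.1
      exacts [huv.2.1, huv.2.2]
  · intro hy
    refine ⟨hcX hy, ?_⟩
    have hxy : y ∈ G.comp x := by rwa [comp_eq hx]
    obtain ⟨-, h⟩ := hxy
    clear hy
    have : y ∈ G.comp c ∧
        Relation.ReflTransGen ((G.induce X).restrict E((G.induce X).induce (G.comp c))).Adj x y := by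
      induction h with
      | refl => exact ⟨hx, .refl⟩
      | @tail u v _ h ih =>
        obtain ⟨e, he, h⟩ := h
        have hv := IsAllowed.mem_comp he h ih.1
        have h' : (G.induce X).IsLink e u v := ⟨h, hcX ih.1, hcX hv⟩
        exact ⟨hv, ih.2.tail ⟨e, ⟨_, _, h', ih.1, hv⟩, h'⟩⟩
    exact this.2

lemma reachSet_eq_singleton (hx : x ∈ X) (hxC : x ∉ C) :
    ((G.induce X).restrict E((G.induce X).induce C)).reachSet x = {x} := by
  ext y
  constructor
  · rintro ⟨-, h⟩
    obtain rfl | ⟨z, ⟨e, ⟨⟨u, v, huv⟩, h⟩⟩, -⟩ := h.cases_head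
    · rfl
    · obtain rfl | rfl := h.1.left_eq_or_eq huv.1.1
      exacts [(hxC huv.2.1).elim, (hxC huv.2.2).elim]
  · rintro rfl
    exact ⟨hx, .refl⟩

lemma isContraction_contractVerts (hcX : G.comp c ⊆ X) :
    G.IsContraction X (G.comp c) ((G.induce X).contractVerts (G.comp c))
      ((G.induce X).restrict E((G.induce X).induce (G.comp c))).reachSet where
  vertexSet_eq := rfl
  isLink_iff e s t := by
    constructor
    · rintro ⟨x, y, ⟨⟨h, hx, hy⟩, he⟩, rfl, rfl⟩
      exact ⟨x, y, h, hx, hy, fun hC ↦ he ⟨x, y, ⟨h, hx, hy⟩, hC⟩, rfl, rfl⟩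
    · rintro ⟨x, y, h, hx, hy, hC, rfl, rfl⟩
      refine ⟨x, y, ⟨⟨h, hx, hy⟩, ?_⟩, rfl, rfl⟩
      rintro ⟨u, v, huv⟩
      obtain ⟨rfl, rfl⟩ | ⟨rfl, rfl⟩ := h.eq_and_eq_or_eq_and_eq huv.1.1
      exacts [hC huv.2, hC huv.2.symm]
  of_mem x hx := reachSet_eq_of_comp hcX hx
  of_notMem x hx hxC := reachSet_eq_singleton hx hxC

variable {K : Graph (Set α) β} {φ : α → Set α}

lemma IsContraction.eq_of_map_eq (hK : G.IsContraction X C K φ) (hx : x ∈ X)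
    (hyC : y ∉ C) (h : φ x = {y}) : x = y := by
  by_cases hxC : x ∈ C
  · rw [hK.of_mem x hxC] at h
    exact (hyC (h ▸ rfl)).elim
  · rw [hK.of_notMem x hx hxC] at h
    exact Set.singleton_injective h

/-- Follow `M` and a perfect matching `N` of `K` minus `{x}` alternately, starting with the `M`-edge
of `x`. Outside `C` only `x` is missed by `N`, so the walk can neither stop nor close up before it
reaches `C`. -/
lemma IsContraction.bal (hK : G.IsContraction X C K φ) (hV : V(G).Finite) (hm : G.IsMate M m)
    (hX : X ⊆ V(G)) (hmX : ∀ x ∈ X, m x ∈ X) (hmC : ∀ x ∈ C, m x ∈ C) (h : K.IsFactorCritical)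
    (hx : x ∈ X) : Bal G.Adj m X C x := by
  by_cases hxC : x ∈ C
  · exact .inl hxC
  have hmC' : ∀ x ∉ C, m x ∉ C := fun x hx h ↦ hx (by simpa [hm.invol] using hmC _ h)
  have hxK : {x} ∈ V(K) := by
    rw [hK.vertexSet_eq, ← hK.of_notMem x hx hxC]
    exact Set.mem_image_of_mem _ hx
  obtain ⟨N, hN⟩ := h _ hxK
  obtain ⟨n1, n2, n3⟩ := isPerfectMatching_deleteVerts_iff.1 hN
  let r : α → α → Prop := fun a b ↦ ∃ e ∈ N, G.IsLink e a b ∧ a ∈ X ∧ b ∈ X ∧ ¬ (a ∈ C ∧ b ∈ C)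
  have hrK : ∀ e a b, G.IsLink e a b ∧ a ∈ X ∧ b ∈ X ∧ ¬ (a ∈ C ∧ b ∈ C) →
      K.IsLink e (φ a) (φ b) := fun e a b ⟨h, ha, hb, hab⟩ ↦
    (hK.isLink_iff e _ _).2 ⟨a, b, h, ha, hb, hab, rfl, rfl⟩
  have hrsymm : ∀ a b, r a b → r b a := fun a b ⟨e, he, h, ha, hb, hab⟩ ↦
    ⟨e, he, h.symm, hb, ha, fun h ↦ hab h.symm⟩
  have hrfun : ∀ a b c, r a b → r a c → b = c := by
    rintro a b c ⟨e, he, h⟩ ⟨f, hf, h'⟩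
    obtain rfl := n3 e he f hf _ (hrK _ _ _ h).inc_left (hrK _ _ _ h').inc_left
    exact h.1.right_unique h'.1
  have hrirr : ∀ a, ¬ r a a := by
    rintro a ⟨e, he, h⟩
    obtain ⟨u, v, hne, -, -, huv⟩ := n1 e he
    obtain ⟨rfl, rfl⟩ | ⟨rfl, rfl⟩ := (hrK _ _ _ h).eq_and_eq_or_eq_and_eq huv <;> exact hne rfl
  have hrx : ∀ a, ¬ r a x := by
    rintro a ⟨e, he, h⟩
    have h' := hrK _ _ _ h
    rw [hK.of_notMem x hx hxC] at h'
    obtain ⟨u, v, -, hu, hv, huv⟩ := n1 e he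
    obtain rfl | rfl := h'.right_eq_or_eq huv
    exacts [hu rfl, hv rfl]
  have hcov : ∀ a ∈ X, a ≠ x → a ∉ C → ∃ b, r a b := by
    intro a ha hax haC
    have haφ := hK.of_notMem a ha haC
    obtain ⟨e, he, t, ht⟩ := n2 {a} (by rw [hK.vertexSet_eq, ← haφ]; exact Set.mem_image_of_mem _ ha)
      (fun h ↦ hax (Set.singleton_injective h))
    obtain ⟨a', b, h1, h2, h3, h4, h5, -⟩ := (hK.isLink_iff e _ _).1 ht
    obtain rfl := hK.eq_of_map_eq h2 haC h5
    exact ⟨b, e, he, h1, h2, h3, h4⟩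
  refine Bal.mono_rel (A := r) (fun a b ⟨e, _, h, _⟩ ↦ ⟨e, h⟩) ?_
  refine exists_alt_of_forall_extend hm.invol (hV.subset hX) hx hxC
    (hcov _ (hmX x hx) (hm.ne x (hX hx)) (hmC' x hxC)) fun l b h1 h2 h3 hbC ↦ ?_
  obtain ⟨d, hd, hdb⟩ := h1.exists_last
  have hb : ∀ c ∈ x :: l, b ≠ c ∧ b ≠ m c := by
    by_contra! hcon
    obtain ⟨c, hc, hbc⟩ := hcon
    have hbx : b = x := h1.eq_head_of_mem_pair hm.invol hrsymm (fun a _ ↦ hrfun a) hrirr hmC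
      (fun y hy ↦ hm.ne y (hX (h3 y hy).1)) h2 (fun y hy ↦ (h3 y hy).2) hc
      (by by_cases h : b = c; exacts [.inl h, .inr (hbc h)])
    exact hrx _ (hbx ▸ hdb)
  obtain ⟨e, -, -, -, hbX, -⟩ := id hdb
  refine ⟨hb, hbX, hcov _ (hmX b hbX) (fun h ↦ ?_) (hmC' b hbC)⟩
  refine (hb x (by simp)).2 ?_
  rw [← h, hm.invol]

/-- The edges of `M` within `X \ C` match all of `K` except the vertex `C`; switching along a path
from `x` to `C` uncovers `{x}` instead. -/
lemma IsContraction.isFactorCritical (hK : G.IsContraction X C K φ) (hM : G.IsPerfectMatching M)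
    (hm : G.IsMate M m) (hX : X ⊆ V(G)) (hmX : ∀ x ∈ X, m x ∈ X) (hmC : ∀ x ∈ C, m x ∈ C)
    (hCX : C ⊆ X) (h : ∀ x ∈ X, Bal G.Adj m X C x) : K.IsFactorCritical := by
  have hmC' : ∀ x ∉ C, m x ∉ C := fun x hx h ↦ hx (by simpa [hm.invol] using hmC _ h)
  obtain ⟨m1, m2, m3⟩ := isPerfectMatching_iff.1 hM
  have hne : ∀ x ∉ C, ({x} : Set α) ≠ C := fun x hx h ↦ hx (h ▸ rfl)
  let N : Set β := {e | e ∈ M ∧ ∃ u v, G.IsLink e u v ∧ u ∈ X ∧ v ∈ X ∧ u ∉ C ∧ v ∉ C}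
  have hlink : ∀ e u v, G.IsLink e u v → u ∈ X → v ∈ X → u ∉ C → v ∉ C → K.IsLink e {u} {v} :=
    fun e u v h hu hv huC hvC ↦ (hK.isLink_iff e _ _).2
      ⟨u, v, h, hu, hv, fun h ↦ huC h.1, hK.of_notMem u hu huC, hK.of_notMem v hv hvC⟩
  have hNm : ∀ y ∈ X, y ∉ C → ∃ e ∈ N, K.IsLink e {y} {m y} := by
    intro y hy hyC
    obtain ⟨e, he, hey⟩ := hm.exists_isLink y (hX hy)
    exact ⟨e, ⟨he, y, m y, hey, hy, hmX y hy, hyC, hmC' y hyC⟩,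
      hlink _ _ _ hey hy (hmX y hy) hyC (hmC' y hyC)⟩
  have hN : (K.deleteVerts (insert C ∅)).IsPerfectMatching N := by
    refine isPerfectMatching_deleteVerts_iff.2 ⟨?_, fun t ht htC ↦ ?_, ?_⟩
    · rintro e ⟨he, u, v, huv, hu, hv, huC, hvC⟩
      refine ⟨{u}, {v}, fun h ↦ ?_, by simpa using hne u huC, by simpa using hne v hvC,
        hlink _ _ _ huv hu hv huC hvC⟩
      obtain rfl := Set.singleton_injective h
      exact hM.1.2.1 e he u huv
    · rw [hK.vertexSet_eq] at ht
      obtain ⟨y, hy, rfl⟩ := ht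
      have hyC : y ∉ C := fun h ↦ htC (by simp [hK.of_mem y h])
      obtain ⟨e, he, hey⟩ := hNm y hy hyC
      rw [hK.of_notMem y hy hyC]
      exact ⟨e, he, hey.inc_left⟩
    · have hinc : ∀ e ∈ N, ∀ t, K.Inc e t → ∃ a, G.Inc e a ∧ t = {a} := by
        rintro e ⟨he, u, v, huv, hu, hv, huC, hvC⟩ t ht
        obtain rfl | rfl := ht.eq_or_eq_of_isLink (hlink _ _ _ huv hu hv huC hvC)
        exacts [⟨u, huv.inc_left, rfl⟩, ⟨v, huv.inc_right, rfl⟩]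
      intro e he f hf t het hft
      obtain ⟨a, ha, rfl⟩ := hinc e he t het
      obtain ⟨b, hb, hab⟩ := hinc f hf _ hft
      obtain rfl := Set.singleton_injective hab
      exact m3 e he.1 f hf.1 a ha hb
  intro s hs
  rw [hK.vertexSet_eq] at hs
  obtain ⟨x, hx, rfl⟩ := hs
  by_cases hxC : x ∈ C
  · rw [hK.of_mem x hxC, ← insert_empty_eq]
    exact ⟨N, hN⟩
  obtain h | ⟨l, b, h1, h2, h3, h4⟩ := h x hx
  · exact (hxC h).elim
  -- The path is transported to `K`, where the vertices outside `C` are singletons and `Set.image m`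
  -- plays the role of `m`.
  have halt : ∀ (l : List α) a, Alt G.Adj m a l b → a ∈ X → a ∉ C → (∀ y ∈ l, y ∈ X ∧ y ∉ C) →
      Alt K.Adj (Set.image m) {a} (l.map fun y ↦ {y}) C := by
    intro l
    induction l with
    | nil =>
      rintro a ⟨e, h⟩ ha haC -
      exact ⟨e, (hK.isLink_iff e _ _).2 ⟨a, b, h, ha, hCX h2, fun h ↦ haC h.1,
        hK.of_notMem a ha haC, hK.of_mem b h2⟩⟩
    | cons y l ih =>
      rintro a ⟨⟨e, h⟩, h'⟩ ha haC hl
      have hy := hl y (by simp)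
      refine ⟨⟨e, hlink _ _ _ h ha hy.1 haC hy.2⟩, ?_⟩
      rw [Set.image_singleton]
      exact ih _ h' (hmX y hy.1) (hmC' y hy.2) fun z hz ↦ hl z (List.mem_cons_of_mem _ hz)
  have hinv : ∀ s : Set α, m '' (m '' s) = s := fun s ↦ by
    rw [Set.image_image]
    simp [hm.invol]
  rw [hK.of_notMem x hx hxC, ← insert_empty_eq]
  have hnd : PairNodup (Set.image m) ({x} :: l.map fun y ↦ {y}) := by
    have := List.Nodup.map (Sym2.map.injective (Set.singleton_injective (α := α))) h3
    rw [List.map_map] at this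
    rw [PairNodup, ← List.map_cons (f := fun y : α ↦ ({y} : Set α)), List.map_map]
    convert this using 2
    funext y
    simp
  have hedge : ∀ s ∈ {x} :: l.map fun y ↦ ({y} : Set α), ∃ e ∈ N, K.IsLink e s (m '' s) := by
    rw [← List.map_cons (f := fun y : α ↦ ({y} : Set α))]
    intro s hs
    obtain ⟨y, hy, rfl⟩ := List.mem_map.1 hs
    rw [Set.image_singleton]
    exact hNm y (h4 y hy).1 (h4 y hy).2
  have hend : Alt K.Adj (Set.image m) (m '' {x}) (l.map fun y ↦ {y}) C := by
    rw [Set.image_singleton]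
    exact halt l _ h1 (hmX x hx) (hmC' x hxC) fun z hz ↦ h4 z (List.mem_cons_of_mem _ hz)
  obtain ⟨N', hN', -⟩ := hN.exists_of_alt hinv (Set.notMem_empty C) hend hnd hedge
  exact ⟨N', hN'⟩

/-- `C` is the vertex set of a factor-component, `X` is separating, and from each vertex in `X`
there is an alternating path in `X` to `C`. -/
structure IsCrit (G : Graph α β) (m : α → α) (C X : Set α) : Prop where
  subset : X ⊆ V(G)
  comp_subset : ∀ x ∈ X, G.comp x ⊆ X
  left_subset : C ⊆ X
  bal : ∀ x ∈ X, Bal G.Adj m X C x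

lemma isCriticalInducing_iff {G₂ : Graph α β} (hV : V(G).Finite) (hM : G.IsPerfectMatching M)
    (hm : G.IsMate M m) :
    G.IsCriticalInducing (G.induce (G.comp c)) G₂ X ↔ G.IsCrit m (G.comp c) X ∧ V(G₂) ⊆ X := by
  have hmC : ∀ x ∈ G.comp c, m x ∈ G.comp c := fun x hx ↦ hm.mem_comp hM hx
  rw [IsCriticalInducing, isSeparating_iff, Set.union_subset_iff, vertexSet_induce]
  constructor
  · rintro ⟨⟨h1, h2⟩, ⟨h3, h4⟩, h5⟩
    exact ⟨⟨h1, h2, h3, fun x hx ↦ (isContraction_contractVerts h3).bal hV hm h1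
      (fun y hy ↦ h2 y hy (hm.mem_comp hM (mem_comp_self (h1 hy)))) hmC h5 hx⟩, h4⟩
  · rintro ⟨⟨h1, h2, h3, h4⟩, h5⟩
    exact ⟨⟨h1, h2⟩, ⟨h3, h5⟩, (isContraction_contractVerts h3).isFactorCritical hM hm h1
      (fun y hy ↦ h2 y hy (hm.mem_comp hM (mem_comp_self (h1 hy)))) hmC h3 h4⟩

end Contraction

/-! ### Ears -/

section Ear

variable {α β : Type*} {G H P Q : Graph α β} {M : Set β} {a b x y : α} {m : α → α} {n j : ℕ}
  {v : ℕ → α} {e : ℕ → β} {p : List α}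

lemma IsTracedBy.isLink (h : P.IsTracedBy n v e) {i : ℕ} (hi : i < n) :
    P.IsLink (e i) (v i) (v (i + 1)) :=
  (h.2 _ _ _).2 ⟨i, hi, rfl, rfl⟩

/-- A circuit can be traced from each of its vertices. -/
lemma IsTracedBy.rotate (h : P.IsTracedBy n v e) (hv : Set.InjOn v {i | i < n}) (hn : v n = v 0)
    (hj : j < n) : ∃ v' e', P.IsTracedBy n v' e' ∧ Set.InjOn v' {i | i < n} ∧ v' 0 = v j ∧
      v' n = v j := by
  have hn0 : 0 < n := by omega
  have hmod : ∀ i, (i + j) % n < n := fun i ↦ Nat.mod_lt _ hn0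
  have hsurj : ∀ k < n, ∃ i < n, (i + j) % n = k := by
    intro k hk
    by_cases hkj : j ≤ k
    · exact ⟨k - j, by omega, by rw [Nat.sub_add_cancel hkj, Nat.mod_eq_of_lt hk]⟩
    · refine ⟨k + n - j, by omega, ?_⟩
      rw [Nat.sub_add_cancel (by omega), Nat.add_mod_right, Nat.mod_eq_of_lt hk]
  have hinj : ∀ i < n, ∀ k < n, (i + j) % n = (k + j) % n → i = k := by
    intro i hi k hk h
    have h' : i ≡ k [MOD n] := Nat.ModEq.add_right_cancel' j h
    exact Nat.ModEq.eq_of_lt_of_lt h' hi hk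
  have hsucc : ∀ i, v ((i + 1 + j) % n) = v ((i + j) % n + 1) := by
    intro i
    have h1 : i + 1 + j = (i + j) + 1 := by omega
    have := hmod i
    -- A circuit consisting of one loop is separate because `1 % n` is then `0`.
    by_cases hn1 : n = 1
    · subst hn1
      simpa [Nat.mod_one] using hn.symm
    rw [h1, Nat.add_mod_eq_ite, Nat.mod_eq_of_lt (show 1 < n by omega)]
    split_ifs with h2
    · have h3 : (i + j) % n + 1 = n := by omega
      rw [h3, Nat.sub_self, hn]
    · rfl
  refine ⟨fun i ↦ v ((i + j) % n), fun i ↦ e ((i + j) % n), ⟨fun x ↦ ?_, fun f x y ↦ ?_⟩, ?_,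
    ?_, ?_⟩
  · rw [h.1]
    constructor
    · rintro ⟨k, hk, rfl⟩
      obtain rfl | hk := hk.eq_or_lt
      · obtain ⟨i, hi, hik⟩ := hsurj 0 hn0
        exact ⟨i, hi.le, by simp only [hik, hn]⟩
      · obtain ⟨i, hi, hik⟩ := hsurj k hk
        exact ⟨i, hi.le, by simp only [hik]⟩
    · rintro ⟨i, -, rfl⟩
      exact ⟨_, (hmod i).le, rfl⟩
  · rw [h.2]
    constructor
    · rintro ⟨k, hk, rfl, h'⟩
      obtain ⟨i, hi, rfl⟩ := hsurj k hk
      exact ⟨i, hi, rfl, by simp only [hsucc]; exact h'⟩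
    · rintro ⟨i, -, rfl, h'⟩
      exact ⟨_, hmod i, rfl, by rw [← hsucc i]; exact h'⟩
  · intro i hi k hk h
    exact hinj i hi k hk (hv (hmod i) (hmod k) h)
  · simp [Nat.mod_eq_of_lt hj]
  · simp [Nat.mod_eq_of_lt hj]

/-- The two kinds of ears have a common description. -/
lemma IsEar.exists_isTracedBy (h : G.IsEar H P) : ∃ n v e, P.IsTracedBy n v e ∧ v 0 ∈ V(H) ∧
    v n ∈ V(H) ∧ (∀ i, 0 < i → i < n → v i ∉ V(H)) ∧
    ∀ i j, 0 < i → i < n → 0 < j → j < n → v i = v j → i = j := by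
  obtain ⟨-, ⟨a, b, ⟨n, v, e, h1, h2, rfl, rfl⟩, h3⟩ | ⟨⟨n, v, e, hn, h1, h2, -, h4⟩, a, h3⟩⟩ := h
  · have hmem : ∀ x, x ∈ V(P) ∩ V(H) ↔ x = v 0 ∨ x = v n := fun x ↦ by rw [h3]; simp
    refine ⟨n, v, e, h1, ((hmem _).2 (.inl rfl)).2, ((hmem _).2 (.inr rfl)).2, fun i hi hin hiH ↦ ?_,
      fun i j _ hi _ hj hij ↦ h2 hi.le hj.le hij⟩
    obtain h | h := (hmem (v i)).1 ⟨(h1.1 _).2 ⟨i, hin.le, rfl⟩, hiH⟩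
    · exact hi.ne' (h2 hin.le (Nat.zero_le n) h)
    · exact hin.ne (h2 hin.le (show n ≤ n from le_rfl) h)
  · have hmem : ∀ x, x ∈ V(P) ∩ V(H) ↔ x = a := fun x ↦ by rw [h3]; simp
    obtain ⟨haP, haH⟩ := (hmem a).2 rfl
    have : ∃ j < n, a = v j := by
      obtain ⟨j, hj, rfl⟩ := (h1.1 a).1 haP
      obtain rfl | hj := hj.eq_or_lt
      exacts [⟨0, hn, h4⟩, ⟨j, hj, rfl⟩]
    obtain ⟨j, hj, rfl⟩ := this
    obtain ⟨v', e', g1, g2, g3, g4⟩ := h1.rotate h2 h4 hj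
    refine ⟨n, v', e', g1, by rwa [g3], by rwa [g4], fun i hi hin hiH ↦ ?_,
      fun i j _ hi _ hj hij ↦ g2 hi hj hij⟩
    have h := (hmem (v' i)).1 ⟨(g1.1 _).2 ⟨i, hin.le, rfl⟩, hiH⟩
    rw [← g3] at h
    exact hi.ne' (g2 hin (hi.trans hin) h)

/-- The interior of the ear is matched in consecutive pairs, so the list consists of the vertices at
odd positions. -/
lemma IsMEar.exists_earList (hm : G.IsMate M m) (h : G.IsMEar M H P) :
    ∃ p, EarList G.Adj m V(H) p ∧ ∀ x ∈ V(P), x ∈ V(H) ∨ x ∈ p ∨ m x ∈ p := by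
  obtain ⟨hear, ⟨a, b, n', v', e', hpath, -⟩, -, -, hperf⟩ := h
  obtain ⟨n, v, e, h1, h2, h3, h4, h5⟩ := hear.exists_isTracedBy
  have hPG : P ≤ G := hear.1
  -- The mate of `v i` is a neighbour on the ear outside `H`. It cannot be the preceding vertex,
  -- which is an end of the ear or is already matched with the vertex before it.
  have hmate : ∀ i, i % 2 = 1 → i < n → i + 1 < n ∧ m (v i) = v (i + 1) := by
    intro i
    induction i using Nat.strong_induction_on with
    | _ i ih =>
    intro hodd hin
    have hiH := h4 i (by omega) hin
    obtain ⟨f, ⟨hfM, -⟩, y, hy⟩ := hperf.2 (v i) (by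
      rw [vertexSet_deleteVerts]
      exact ⟨(h1.1 _).2 ⟨i, hin.le, rfl⟩, hiH⟩)
    obtain ⟨hy, -, hyH⟩ := (deleteVerts_isLink ..).1 hy
    have hmy : m (v i) = y := hm.eq_of_isLink f hfM _ _ (hy.mono hPG)
    obtain ⟨k, hk, rfl, hs⟩ := (h1.2 _ _ _).1 hy
    rw [Sym2.eq_iff] at hs
    obtain ⟨hs1, rfl⟩ | ⟨hs1, rfl⟩ := hs
    · have hk0 : 0 < k := by
        rw [Nat.pos_iff_ne_zero]
        rintro rfl
        exact hiH (hs1 ▸ h2)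
      obtain rfl := h5 i k (by omega) hin hk0 hk hs1
      refine ⟨?_, hmy⟩
      refine lt_of_le_of_ne (by omega) fun h ↦ ?_
      rw [h] at hyH
      exact hyH h3
    · have hk1 : k + 1 < n := by
        refine lt_of_le_of_ne (by omega) fun h ↦ ?_
        rw [h] at hs1
        exact hiH (hs1 ▸ h3)
      obtain rfl := h5 i (k + 1) (by omega) hin (by omega) hk1 hs1
      have hk0 : k ≠ 0 := by
        rintro rfl
        exact hyH h2
      obtain ⟨k, rfl⟩ := Nat.exists_eq_succ_of_ne_zero hk0
      obtain ⟨-, hk'⟩ := ih k (by omega) (by omega) (by omega)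
      have : v (k + 1 + 1) = v k := by rw [← hm.invol (v (k + 1 + 1)), hmy, ← hm.invol (v k), hk']
      have := h5 _ _ (by omega) hin (by omega) (by omega) this
      omega
  have hn : ∃ k, n = 2 * k + 1 ∧ k ≠ 0 := by
    have hv' : v' 0 ∈ V(P.deleteVerts V(H)) := (hpath.1 _).2 ⟨0, Nat.zero_le _, rfl⟩
    rw [vertexSet_deleteVerts] at hv'
    obtain ⟨i, hi, hvi⟩ := (h1.1 _).1 hv'.1
    rw [hvi] at hv'
    have hi0 : i ≠ 0 := by
      rintro rfl
      exact hv'.2 h2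
    have hin : i ≠ n := by
      rintro rfl
      exact hv'.2 h3
    have h1n := (hmate 1 rfl (by omega)).1
    by_cases hodd : n % 2 = 1
    · exact ⟨n / 2, by omega, by omega⟩
    · have := (hmate (n - 1) (by omega) (by omega)).1
      omega
  have key : ∀ k s, n = s + (2 * k + 1) → s % 2 = 0 → ∃ p : List α, p.length = k ∧
      Alt G.Adj m (v s) p (v n) ∧ PairNodup m p ∧
      (∀ x ∈ p, ∃ i, s < i ∧ i < n ∧ i % 2 = 1 ∧ x = v i) ∧
      ∀ i, s < i → i < n → v i ∈ p ∨ m (v i) ∈ p := by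
    intro k
    induction k with
    | zero =>
      intro s hs _
      obtain rfl : n = s + 1 := by omega
      exact ⟨[], rfl, ⟨_, (h1.isLink (by omega)).mono hPG⟩, by simp [PairNodup], by simp,
        fun i _ _ ↦ by omega⟩
    | succ k ih =>
      intro s hs hs2
      obtain ⟨p, g0, g1, g2, g3, g4⟩ := ih (s + 2) (by omega) (by omega)
      have hms := (hmate (s + 1) (by omega) (by omega)).2
      refine ⟨v (s + 1) :: p, by simp [g0], ⟨⟨_, (h1.isLink (by omega)).mono hPG⟩, ?_⟩,
        (pairNodup_cons hm.invol).2 ⟨g2, fun y hy ↦ ?_⟩, fun x hx ↦ ?_, fun i hi hin ↦ ?_⟩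
      · rw [hms]
        exact g1
      · obtain ⟨i, hi1, hi2, hi3, rfl⟩ := g3 y hy
        obtain ⟨hi4, hi5⟩ := hmate i hi3 hi2
        refine ⟨fun h ↦ ?_, fun h ↦ ?_⟩
        · have := h5 _ _ (by omega) (by omega) (by omega) hi2 h
          omega
        · rw [hi5] at h
          have := h5 _ _ (by omega) (by omega) (by omega) hi4 h
          omega
      · obtain rfl | hx := List.mem_cons.1 hx
        · exact ⟨s + 1, by omega, by omega, by omega, rfl⟩
        · obtain ⟨i, hi1, hi2, hi3, rfl⟩ := g3 x hx
          exact ⟨i, by omega, hi2, hi3, rfl⟩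
      · obtain rfl | hi1 : i = s + 1 ∨ s + 1 < i := by omega
        · simp
        obtain rfl | hi2 : i = s + 2 ∨ s + 2 < i := by omega
        · right
          rw [← hms, hm.invol]
          simp
        · exact (g4 i hi2 hin).imp (List.mem_cons_of_mem _) (List.mem_cons_of_mem _)
  obtain ⟨k, hk, hk0⟩ := hn
  obtain ⟨p, g0, g1, g2, g3, g4⟩ := key k 0 (by omega) rfl
  refine ⟨p, ⟨?_, g2, fun x hx ↦ ?_, _, h2, _, h3, g1⟩, fun x hx ↦ ?_⟩
  · rintro rfl
    exact hk0 g0.symm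
  · obtain ⟨i, hi1, hi2, -, rfl⟩ := g3 x hx
    exact h4 i hi1 hi2
  · obtain ⟨i, hi, rfl⟩ := (h1.1 x).1 hx
    obtain rfl | hi0 := Nat.eq_zero_or_pos i
    · exact .inl h2
    obtain rfl | hin := hi.eq_or_lt
    · exact .inl h3
    · exact .inr (g4 i hi0 hin)

/-! ### From alternating lists back to ears -/

/-- A sequence of consecutive edges traces a subgraph. -/
lemma exists_isTracedBy (hv : ∀ i ≤ n, v i ∈ V(G))
    (he : ∀ i < n, G.IsLink (e i) (v i) (v (i + 1))) : ∃ P ≤ G, P.IsTracedBy n v e := by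
  refine ⟨(G.restrict {f | ∃ i < n, f = e i}).induce {x | ∃ i ≤ n, x = v i}, ?_, fun x ↦ Iff.rfl,
    fun f x y ↦ ⟨?_, ?_⟩⟩
  · refine (induce_le ?_).trans restrict_le
    rintro x ⟨i, hi, rfl⟩
    exact hv i hi
  · rintro ⟨⟨⟨i, hi, rfl⟩, h⟩, -, -⟩
    exact ⟨i, hi, rfl, (h.isLink_iff_sym2_eq).1 (he i hi)⟩
  · rintro ⟨i, hi, rfl, h⟩
    refine ⟨⟨⟨i, hi, rfl⟩, (he i hi).isLink_iff_sym2_eq.2 h.symm⟩, ?_⟩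
    rw [Sym2.eq_iff] at h
    obtain ⟨rfl, rfl⟩ | ⟨rfl, rfl⟩ := h
    exacts [⟨⟨i, hi.le, rfl⟩, i + 1, hi, rfl⟩, ⟨⟨i + 1, hi, rfl⟩, i, hi.le, rfl⟩]

lemma IsTracedBy.inc (h : Q.IsTracedBy n v e) {i : ℕ} (hi : i < n) (hx : Q.Inc (e i) x) :
    x = v i ∨ x = v (i + 1) :=
  hx.eq_or_eq_of_isLink (h.isLink hi)

lemma IsTracedBy.exists_of_mem_edgeSet (h : Q.IsTracedBy n v e) {f : β} (hf : f ∈ E(Q)) :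
    ∃ i < n, f = e i := by
  obtain ⟨x, y, hxy⟩ := exists_isLink_of_mem_edgeSet hf
  obtain ⟨i, hi, rfl, -⟩ := (h.2 _ _ _).1 hxy
  exact ⟨i, hi, rfl⟩

/-- The edges at even positions already cover every vertex. Edges outside `M` can only be at odd
positions and are therefore disjoint. -/
lemma IsTracedBy.isSaturatedPath (h : Q.IsTracedBy n v e) (hv : Set.InjOn v {i | i ≤ n})
    (hQ : Q ≤ G) (hM : G.IsMatching M) (hn : n % 2 = 1)
    (he : ∀ i < n, i % 2 = 0 → e i ∈ M) : Q.IsSaturatedPath M := by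
  have hinj : Set.InjOn e {i | i < n} := by
    intro i hi j hj hij
    simp only [Set.mem_ofPred_eq] at hi hj
    have h1 := h.isLink hi
    rw [hij] at h1
    obtain ⟨h2, -⟩ | ⟨h2, h3⟩ := h1.eq_and_eq_or_eq_and_eq (h.isLink hj)
    · exact hv hi.le hj.le h2
    · have h4 : i = j + 1 := hv hi.le hj h2
      have h5 : i + 1 = j := hv hi hj.le h3
      omega
  have hE : E(Q) = e '' {i | i < n} := by
    ext f
    constructor
    · intro hf
      obtain ⟨i, hi, rfl⟩ := h.exists_of_mem_edgeSet hf
      exact ⟨i, hi, rfl⟩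
    · rintro ⟨i, hi, rfl⟩
      exact (h.isLink hi).edge_mem
  have hloop : ∀ f x, ¬ Q.IsLoopAt f x := by
    intro f x hf
    obtain ⟨i, hi, -, hs⟩ := (h.2 _ _ _).1 hf
    rw [Sym2.eq_iff] at hs
    have h1 : v i = v (i + 1) := by
      obtain ⟨h1, h2⟩ | ⟨h1, h2⟩ := hs
      exacts [h1.symm.trans h2, h2.symm.trans h1]
    have : i = i + 1 := hv hi.le hi h1
    omega
  refine ⟨⟨_, _, n, v, e, h, hv, rfl, rfl⟩, ⟨Set.sdiff_subset, fun f _ x ↦ hloop f x, ?_⟩, ?_,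
    ⟨⟨Set.inter_subset_right, fun f _ x ↦ hloop f x, ?_⟩, fun x hx ↦ ?_⟩⟩
  · rintro f ⟨hf, hfM⟩ g ⟨hg, hgM⟩ hne x ⟨hfx, hgx⟩
    obtain ⟨i, hi, rfl⟩ := h.exists_of_mem_edgeSet hf
    obtain ⟨j, hj, rfl⟩ := h.exists_of_mem_edgeSet hg
    have hi2 : i % 2 ≠ 0 := fun h ↦ hfM (he i hi h)
    have hj2 : j % 2 ≠ 0 := fun h ↦ hgM (he j hj h)
    have hij : i ≠ j := by
      rintro rfl
      exact hne rfl
    obtain h1 | h1 := h.inc hi hfx <;> obtain h2 | h2 := h.inc hj hgx <;> rw [h1] at h2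
    · exact hij (hv hi.le hj.le h2)
    · have : i = j + 1 := hv hi.le hj h2
      omega
    · have : i + 1 = j := hv hi hj.le h2
      omega
    · have : i + 1 = j + 1 := hv hi hj h2
      omega
  · rw [hE, hinj.ncard_image, Nat.odd_iff]
    have : {i | i < n} = Set.Iio n := rfl
    rw [this, Set.ncard_eq_toFinset_card', Set.toFinset_Iio, Nat.card_Iio]
    exact hn
  · rintro f ⟨hf, -⟩ g ⟨hg, -⟩ hne x ⟨hfx, hgx⟩
    exact hM.2.2 f hf g hg hne x ⟨hfx.mono hQ, hgx.mono hQ⟩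
  · obtain ⟨i, hi, rfl⟩ := (h.1 x).1 hx
    by_cases hi2 : i % 2 = 0
    · have hin : i < n := lt_of_le_of_ne hi (by rintro rfl; omega)
      exact ⟨e i, ⟨he i hin hi2, (h.isLink hin).edge_mem⟩, (h.isLink hin).inc_left⟩
    · obtain ⟨i, rfl⟩ : ∃ k, i = k + 1 := ⟨i - 1, by omega⟩
      exact ⟨e i, ⟨he i hi (by omega), (h.isLink hi).edge_mem⟩, (h.isLink hi).inc_right⟩

/-- The `i`-th pair, counted from `0`, occupies positions `2 * i + 1` and `2 * i + 2`. Only interior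
positions are claimed distinct, since the two ends may coincide. -/
lemma Alt.exists_trace (hm : G.IsMate M m) (h : Alt G.Adj m a p b) (hp : PairNodup m p) :
    ∃ (v : ℕ → α) (e : ℕ → β), v 0 = a ∧ v (2 * p.length + 1) = b ∧
      (∀ i < 2 * p.length + 1, G.IsLink (e i) (v i) (v (i + 1))) ∧
      (∀ i < 2 * p.length + 1, i % 2 = 1 → e i ∈ M) ∧
      (∀ i, 0 < i → i < 2 * p.length + 1 → v i ∈ p ∨ m (v i) ∈ p) ∧
      (∀ i j, 0 < i → i < 2 * p.length + 1 → 0 < j → j < 2 * p.length + 1 → v i = v j → i = j) ∧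
      ∀ x ∈ p, ∃ i < 2 * p.length + 1, x = v i := by
  induction p generalizing a with
  | nil =>
    obtain ⟨f, hf⟩ := h
    refine ⟨fun | 0 => a | _ => b, fun _ ↦ f, rfl, rfl, ?_, ?_, ?_, ?_, ?_⟩
    · intro i hi
      obtain rfl : i = 0 := by simpa using hi
      exact hf
    all_goals simp; try omega
  | cons x p ih =>
    obtain ⟨⟨f, hf⟩, h⟩ := h
    obtain ⟨hp, hx⟩ := (pairNodup_cons hm.invol).1 hp
    obtain ⟨v, e, h1, h2, h3, h4, h5, h6, h7⟩ := ih h hp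
    obtain ⟨g, hg, hgx⟩ := hm.exists_isLink x hf.right_mem
    have hlen : 2 * (x :: p).length + 1 = (2 * p.length + 1) + 2 := by simp; ring
    have hne := hm.ne x hf.right_mem
    have hmx : ∀ i, i < 2 * p.length + 1 → x ≠ v i := by
      rintro (_ | i) hi rfl
      · rw [← h1] at hne
        exact hne rfl
      · obtain h | h := h5 (i + 1) (by omega) hi
        · exact (hx _ h).1 rfl
        · exact (hx _ h).2 (hm.invol _).symm
    have hmx' : ∀ i, 0 < i → i < 2 * p.length + 1 → m x ≠ v i := by
      intro i hi0 hi h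
      obtain h' | h' := h5 i hi0 hi
      · refine (hx _ h').2 ?_
        rw [← h, hm.invol]
      · refine (hx _ h').1 ?_
        rw [← h, hm.invol]
    rw [hlen]
    refine ⟨fun | 0 => a | 1 => x | i + 2 => v i, fun | 0 => f | 1 => g | i + 2 => e i, rfl, h2,
      ?_, ?_, ?_, ?_, ?_⟩
    · rintro (_ | _ | i) hi
      · exact hf
      · simp only [h1]
        exact hgx
      · exact h3 i (by omega)
    · rintro (_ | _ | i) hi hi2
      · omega
      · exact hg
      · exact h4 i (by omega) (by omega)
    · rintro (_ | _ | _ | i) hi hi'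
      · omega
      · simp
      · simp [h1, hm.invol]
      · exact (h5 (i + 1) (by omega) (by omega)).imp (List.mem_cons_of_mem _)
          (List.mem_cons_of_mem _)
    · rintro (_ | _ | _ | i) (_ | _ | _ | j) hi hi' hj hj' hij <;> simp only at hij <;>
        try omega
      · exact (hmx _ (by omega) hij).elim
      · exact (hmx _ (by omega) hij).elim
      · exact (hmx _ (by omega) hij.symm).elim
      · exact (hmx' _ (by omega) (by omega) (h1 ▸ hij)).elim
      · exact (hmx _ (by omega) hij.symm).elim
      · exact (hmx' _ (by omega) (by omega) (h1 ▸ hij.symm)).elim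
      · have := h6 (i + 1) (j + 1) (by omega) (by omega) (by omega) (by omega) hij
        omega
    · intro y hy
      obtain rfl | hy := List.mem_cons.1 hy
      · exact ⟨1, by omega, rfl⟩
      · obtain ⟨i, hi, rfl⟩ := h7 y hy
        exact ⟨i + 2, by omega, rfl⟩

lemma EarList.exists_isMEar (hM : G.IsPerfectMatching M) (hm : G.IsMate M m)
    (hmH : ∀ x ∈ V(H), m x ∈ V(H)) (h : EarList G.Adj m V(H) p) :
    ∃ P, G.IsMEar M H P ∧ ∀ x ∈ p, x ∈ V(P) := by
  obtain ⟨hp0, hp, hpH, a, ha, b, hb, halt⟩ := h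
  obtain ⟨v, e, h1, h2, h3, h4, h5, h6, h7⟩ := halt.exists_trace hm hp
  have hlen : 0 < p.length := List.length_pos_iff.2 hp0
  obtain ⟨n, hn⟩ : ∃ n, n = 2 * p.length + 1 := ⟨_, rfl⟩
  rw [← hn] at h2 h3 h4 h5 h6 h7
  have hvH : ∀ i, 0 < i → i < n → v i ∉ V(H) := by
    intro i hi hin hiH
    obtain h | h := h5 i hi hin
    exacts [hpH _ h hiH, hpH _ h (hmH _ hiH)]
  have hv0 : v 0 ∈ V(H) := h1 ▸ ha
  have hvn : v n ∈ V(H) := h2 ▸ hb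
  obtain ⟨P, hPG, hP⟩ : ∃ P ≤ G, P.IsTracedBy n v e := by
    refine exists_isTracedBy (fun i hi ↦ ?_) h3
    obtain rfl | hi := hi.eq_or_lt
    · obtain ⟨i, rfl⟩ : ∃ k, i = k + 1 := ⟨i - 1, by omega⟩
      exact (h3 i (by omega)).right_mem
    · exact (h3 i hi).left_mem
  have hint : ∀ i ≤ n, v i ∈ V(H) → i = 0 ∨ i = n := by
    intro i hi hiH
    by_contra! hcon
    exact hvH i (by omega) (by omega) hiH
  have hcap : V(P) ∩ V(H) = {v 0, v n} := by
    ext x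
    constructor
    · rintro ⟨hxP, hxH⟩
      obtain ⟨i, hi, rfl⟩ := (hP.1 x).1 hxP
      obtain rfl | rfl := hint i hi hxH <;> simp
    · rintro (rfl | rfl)
      exacts [⟨(hP.1 _).2 ⟨0, Nat.zero_le _, rfl⟩, hv0⟩, ⟨(hP.1 _).2 ⟨n, le_rfl, rfl⟩, hvn⟩]
  have hinj : Set.InjOn v {i | i < n} := by
    intro i hi j hj hij
    simp only [Set.mem_ofPred_eq] at hi hj
    obtain rfl | hi0 := Nat.eq_zero_or_pos i
    · obtain h | h := hint j hj.le (hij ▸ hv0) <;> omega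
    obtain rfl | hj0 := Nat.eq_zero_or_pos j
    · obtain h | h := hint i hi.le (hij ▸ hv0) <;> omega
    exact h6 i j hi0 hi hj0 hj hij
  refine ⟨P, ⟨⟨hPG, ?_⟩, ?_⟩, fun x hx ↦ ?_⟩
  · by_cases hab : v 0 = v n
    · right
      refine ⟨⟨n, v, e, by omega, hP, hinj, fun i hi j hj hij ↦ ?_, hab.symm⟩, v 0, ?_⟩
      -- Two positions with the same edge would force a circuit of length at most two, but an ear
      -- with a matched pair in its interior has `n ≥ 3`.
      · simp only [Set.mem_ofPred_eq] at hi hj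
        have hl := hP.isLink hi
        rw [hij] at hl
        obtain ⟨g1, -⟩ | ⟨g1, g2⟩ := hl.eq_and_eq_or_eq_and_eq (hP.isLink hj)
        · exact hinj hi hj g1
        · by_cases hj1 : j + 1 < n
          · have g3 : i = j + 1 := hinj hi hj1 g1
            by_cases hi1 : i + 1 < n
            · have g4 : i + 1 = j := hinj hi1 hj g2
              omega
            · rw [show i + 1 = n by omega, ← hab] at g2
              have g4 : 0 = j := hinj (by simp; omega) hj g2
              omega
          · rw [show j + 1 = n by omega, ← hab] at g1
            have g3 : i = 0 := hinj hi (by simp; omega) g1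
            subst g3
            have g4 : 0 + 1 = j := hinj (by simp; omega) hj g2
            omega
      · rw [hcap, ← hab, Set.pair_eq_singleton]
    · left
      refine ⟨v 0, v n, ⟨n, v, e, hP, fun i hi j hj hij ↦ ?_, rfl, rfl⟩, hcap⟩
      simp only [Set.mem_ofPred_eq] at hi hj
      obtain rfl | hi1 := hi.eq_or_lt
      · obtain rfl | rfl := hint j hj (hij ▸ hvn)
        exacts [(hab hij.symm).elim, rfl]
      obtain rfl | hj1 := hj.eq_or_lt
      · obtain rfl | rfl := hint i hi (hij ▸ hvn)
        exacts [(hab hij).elim, rfl]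
      exact hinj hi1 hj1 hij
  -- Deleting both ends shifts positions by one, so the matching edges move from odd to even
  -- positions.
  · have hQ : (P.deleteVerts V(H)).IsTracedBy (n - 2) (fun i ↦ v (i + 1)) (fun i ↦ e (i + 1)) := by
      refine ⟨fun x ↦ ?_, fun f x y ↦ ?_⟩
      · rw [vertexSet_deleteVerts]
        constructor
        · rintro ⟨hxP, hxH⟩
          obtain ⟨i, hi, rfl⟩ := (hP.1 x).1 hxP
          have hi0 : i ≠ 0 := by
            rintro rfl
            exact hxH hv0
          have hin : i ≠ n := by
            rintro rfl
            exact hxH hvn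
          exact ⟨i - 1, by omega, by simp only [Nat.sub_add_cancel (show 1 ≤ i by omega)]⟩
        · rintro ⟨i, hi, rfl⟩
          exact ⟨(hP.1 _).2 ⟨i + 1, by omega, rfl⟩, hvH _ (by omega) (by omega)⟩
      · rw [deleteVerts_isLink, hP.2]
        constructor
        · rintro ⟨⟨i, hi, rfl, hs⟩, hx, hy⟩
          have hs' : v i ∉ V(H) ∧ v (i + 1) ∉ V(H) := by
            rw [Sym2.eq_iff] at hs
            obtain ⟨rfl, rfl⟩ | ⟨rfl, rfl⟩ := hs
            exacts [⟨hx, hy⟩, ⟨hy, hx⟩]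
          have hi0 : i ≠ 0 := by
            rintro rfl
            exact hs'.1 hv0
          have hin : i + 1 ≠ n := by
            rintro rfl
            exact hs'.2 hvn
          obtain ⟨i, rfl⟩ : ∃ k, i = k + 1 := ⟨i - 1, by omega⟩
          exact ⟨i, by omega, rfl, hs⟩
        · rintro ⟨i, hi, rfl, hs⟩
          refine ⟨⟨i + 1, by omega, rfl, hs⟩, ?_⟩
          have hi1 := hvH (i + 1) (by omega) (by omega)
          have hi2 := hvH (i + 1 + 1) (by omega) (by omega)
          rw [Sym2.eq_iff] at hs
          obtain ⟨rfl, rfl⟩ | ⟨rfl, rfl⟩ := hs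
          exacts [⟨hi1, hi2⟩, ⟨hi2, hi1⟩]
    refine hQ.isSaturatedPath (fun i hi j hj hij ↦ ?_) (deleteVerts_le.trans hPG) hM.1 (by omega)
      fun i hi hi2 ↦ h4 _ (by omega) (by omega)
    simp only [Set.mem_ofPred_eq] at hi hj
    have : i + 1 = j + 1 := h6 _ _ (by omega) (by omega) (by omega) (by omega) hij
    omega
  · obtain ⟨i, hi, rfl⟩ := h7 x hx
    exact (hP.1 _).2 ⟨i, hi.le, rfl⟩

end Ear

/-! ### Ear sequences -/

section EarSequence

variable {α β : Type*} {G H H' : Graph α β} {M : Set β} {a b c u w x y z : α} {m : α → α}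
  {p r s l : List α} {C C' R T U W X X' Z : Set α} {A : α → α → Prop}

lemma PairNodup.perm (h : PairNodup m l) (hl : l.Perm r) : PairNodup m r :=
  (hl.map _).nodup_iff.1 h

lemma Alt.exists_prefix_right (h : Alt A m a (p ++ s) b) (hb : b ∈ T) :
    ∃ s' b', s' <+: s ∧ Alt A m a (p ++ s') b' ∧ b' ∈ T ∧ ∀ x ∈ s', x ∉ T := by
  induction p generalizing a with
  | nil => exact h.exists_prefix hb
  | cons y p ih =>
    obtain ⟨s', b', h1, h2, h3⟩ := ih h.2
    exact ⟨s', b', h1, ⟨h.1, h2⟩, h3⟩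

lemma Alt.mem_vertexSet (h : Alt G.Adj m a p b) (hx : x ∈ p) : x ∈ V(G) := by
  induction p generalizing a with
  | nil => simp at hx
  | cons y p ih =>
    obtain rfl | hx := List.mem_cons.1 hx
    exacts [h.1.right_mem, ih h.2 hx]

lemma EarList.bal (h : EarList A m T p) (hx : x ∈ p) (hW : ∀ y ∈ p, y ∈ W) : Bal A m W T x := by
  obtain ⟨-, h1, h2, a, -, b, hb, h3⟩ := h
  obtain ⟨p₁, p₂, rfl⟩ := List.append_of_mem hx
  refine .inr ⟨p₂, b, (alt_append.1 h3).2, hb, h1.sublist (List.sublist_append_right _ _),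
    fun y hy ↦ ?_⟩
  have hy' : y ∈ p₁ ++ x :: p₂ := List.mem_append_right _ hy
  exact ⟨hW y hy', h2 y hy'⟩

/-- An alternating path from `u` to `Z` and a further one from a neighbour of `u` to `Z` form an
ear relative to `Z`. -/
lemma Bal.exists_earList (hA : ∀ x y, A x y → A y x) (hm : ∀ x, m (m x) = x)
    (hZ : ∀ x ∈ Z, m x ∈ Z) (hu : Bal A m R Z u) (hps : Alt A m u (p ++ s) z) (hz : z ∈ Z)
    (hp0 : p ≠ []) (hp : ∀ x ∈ p, x ∉ Z) (hnd : PairNodup m (p ++ s))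
    (hR : ∀ x ∈ p ++ s, x ∉ R ∧ m x ∉ R) : ∃ l, EarList A m Z l ∧ ∀ x ∈ p, x ∈ l := by
  obtain ⟨s', b, hs', h1, hb, h2⟩ := hps.exists_prefix_right hz
  have hsub : (p ++ s').Sublist (p ++ s) := hs'.sublist.append_left p
  have hpZ : ∀ x ∈ p ++ s', x ∉ Z := fun x hx ↦ (List.mem_append.1 hx).elim (hp x) (h2 x)
  obtain hu | ⟨l, g, g1, g2, g3, g4⟩ := hu
  · exact ⟨p ++ s', ⟨by simp [hp0], hnd.sublist hsub, hpZ, u, hu, b, hb, h1⟩,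
      fun x hx ↦ List.mem_append_left _ hx⟩
  refine ⟨((u :: l).map m).reverse ++ (p ++ s'), ⟨by simp, ?_, fun x hx ↦ ?_, g, g2, b, hb, ?_⟩,
    fun x hx ↦ List.mem_append_right _ (List.mem_append_left _ hx)⟩
  · refine (pairNodup_append hm).2 ⟨g3.reverse hm, hnd.sublist hsub, fun x hx y hy ↦ ?_⟩
    obtain ⟨t, ht, rfl⟩ := List.mem_map.1 (List.mem_reverse.1 hx)
    have h3 := hR y (hsub.subset hy)
    constructor
    · rintro rfl
      rw [hm] at h3
      exact h3.2 (g4 t ht).1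
    · intro h
      have h' : t = y := by rw [← hm t, h, hm]
      exact h3.1 (h' ▸ (g4 t ht).1)
  · obtain hx | hx := List.mem_append.1 hx
    · obtain ⟨t, ht, rfl⟩ := List.mem_map.1 (List.mem_reverse.1 hx)
      intro h
      exact (g4 t ht).2 (by simpa [hm] using hZ _ h)
    · exact hpZ x hx
  · simp only [List.map_cons, List.reverse_cons, List.append_assoc, List.singleton_append]
    exact alt_append.2 ⟨g1.reverse hA hm, by rwa [hm]⟩

lemma IsCrit.mate_mem (h : G.IsCrit m C X) (hM : G.IsPerfectMatching M) (hm : G.IsMate M m)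
    (hx : x ∈ X) : m x ∈ X :=
  h.comp_subset x hx (hm.mem_comp hM (mem_comp_self (h.subset hx)))

/-- This is transitivity: a path in `X'` towards `C' ⊆ X` is cut where it first meets `X` and
continued inside `X` to `C`. -/
lemma IsCrit.union (hM : G.IsPerfectMatching M) (hm : G.IsMate M m) (h : G.IsCrit m C X)
    (h' : G.IsCrit m C' X') (hC' : C' ⊆ X) : G.IsCrit m C (X ∪ X') where
  subset := Set.union_subset h.subset h'.subset
  comp_subset x hx := hx.elim (fun hx ↦ (h.comp_subset x hx).trans Set.subset_union_left)
    fun hx ↦ (h'.comp_subset x hx).trans Set.subset_union_right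
  left_subset := h.left_subset.trans Set.subset_union_left
  bal x hx := by
    obtain hx | hx := hx
    · exact (h.bal x hx).mono Set.subset_union_left
    · exact (((h'.bal x hx).mono Set.subset_union_right).superset hC').trans hm.invol
        (fun y hy ↦ h.mate_mem hM hm hy) h.left_subset Set.subset_union_left h.bal

lemma isCrit_comp : G.IsCrit m (G.comp c) (G.comp c) where
  subset := comp_subset
  comp_subset _ hx := (comp_eq hx).subset
  left_subset := subset_rfl
  bal _ hx := .inl hx

/-- From a vertex of a factor-component met by the ear, go inside that component to a pair of the
ear, stop at the first vertex on the ear or in the factor-component of `c`, and follow the ear in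
the direction that starts with the matching edge. -/
lemma EarList.isCrit (hM : G.IsPerfectMatching M) (hm : G.IsMate M m) (hV : V(G).Finite)
    (h : EarList G.Adj m (G.comp c) p) :
    G.IsCrit m (G.comp c) {y | y ∈ G.comp c ∨ ∃ x ∈ p, y ∈ G.comp x} := by
  have hpV : ∀ x ∈ p, x ∈ V(G) := by
    obtain ⟨-, -, -, a, -, b, -, h⟩ := h
    exact fun x hx ↦ h.mem_vertexSet hx
  refine ⟨?_, ?_, fun _ ↦ .inl, ?_⟩
  · rintro y (hy | ⟨x, -, hy⟩) <;> exact hy.1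
  · rintro y (hy | ⟨x, hx, hy⟩) z hz <;> rw [comp_eq hy] at hz
    exacts [.inl hz, .inr ⟨x, hx, hz⟩]
  rintro y (hy | ⟨x, hx, hy⟩)
  · exact .inl hy
  have hxy : x ∈ G.comp y := by
    rw [comp_eq hy]
    exact mem_comp_self (hpV x hx)
  have hcomp : G.comp y ⊆ {y | y ∈ G.comp c ∨ ∃ x ∈ p, y ∈ G.comp x} := fun z hz ↦
    .inr ⟨x, hx, comp_eq hy ▸ hz⟩
  have hmc : ∀ t ∈ G.comp c, m t ∈ G.comp c := fun t ht ↦ hm.mem_comp hM ht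
  refine (((hM.bal_comp hm hV hxy).mono hcomp).superset
    (T := {t | t ∈ G.comp c ∨ t ∈ p ∨ m t ∈ p}) ?_).trans hm.invol ?_ (fun _ ↦ .inl) ?_ ?_
  · rintro t (rfl | rfl)
    · exact .inr (.inl hx)
    · exact .inr (.inr (by rwa [hm.invol]))
  · rintro t (ht | ht | ht)
    · exact .inl (hmc t ht)
    · exact .inr (.inr (by rwa [hm.invol]))
    · exact .inr (.inl ht)
  · rintro t (ht | ht | ht)
    · exact .inl ht
    · exact .inr ⟨t, ht, mem_comp_self (hpV t ht)⟩
    · refine .inr ⟨m t, ht, ?_⟩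
      simpa [hm.invol] using hm.mem_comp hM (mem_comp_self (hpV _ ht))
  · rintro t (ht | ht | ht)
    · exact .inl ht
    · exact h.bal ht fun y hy ↦ .inr (.inl hy)
    · refine (h.reverse (fun _ _ h ↦ h.symm) hm.invol hmc).bal ?_ fun y hy ↦ ?_
      · simp only [List.mem_reverse, List.mem_map]
        exact ⟨m t, ht, hm.invol t⟩
      · simp only [List.mem_reverse, List.mem_map] at hy
        obtain ⟨z, hz, rfl⟩ := hy
        exact .inr (.inr (by rwa [hm.invol]))

/-! ### The set of vertices reached by ears -/

/-- There is an `M`-ear relative to the factor-component `H` and through the factor-component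
`H'`. -/
def EarStep (G : Graph α β) (M : Set β) (H H' : Graph α β) : Prop :=
  G.IsFactorComponent H ∧ G.IsFactorComponent H' ∧
    ∃ P, G.IsMEar M H P ∧ (V(P) ∩ V(H')).Nonempty

/-- The vertices whose factor-component can be reached by ears from the factor-component of `c`. -/
def earReach (G : Graph α β) (M : Set β) (c : α) : Set α :=
  {v | v ∈ V(G) ∧
    Relation.ReflTransGen (G.EarStep M) (G.induce (G.comp c)) (G.induce (G.comp v))}

lemma comp_subset_earReach (hx : x ∈ G.earReach M c) : G.comp x ⊆ G.earReach M c := fun y hy ↦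
  ⟨hy.1, by rw [comp_eq hy]; exact hx.2⟩

lemma EarList.earStep (hM : G.IsPerfectMatching M) (hm : G.IsMate M m) (hz : z ∈ V(G))
    (h : EarList G.Adj m (G.comp z) p) (hx : x ∈ p) :
    G.EarStep M (G.induce (G.comp z)) (G.induce (G.comp x)) := by
  obtain ⟨P, hP, hpP⟩ := EarList.exists_isMEar (H := G.induce (G.comp z)) hM hm
    (fun y hy ↦ hm.mem_comp hM hy) h
  have hxV : x ∈ V(G) := hP.1.1.vertexSet_mono (hpP x hx)
  exact ⟨isFactorComponent_induce_comp hz, isFactorComponent_induce_comp hxV, P, hP, x, hpP x hx,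
    mem_comp_self hxV⟩

/-- Each further ear contributes its own set, joined by `IsCrit.union`. The bound `X ⊆ G.earReach M
c` keeps the resulting paths inside the reached set. -/
lemma exists_isCrit_of_reflTransGen (hM : G.IsPerfectMatching M) (hm : G.IsMate M m)
    (hV : V(G).Finite) (hc : c ∈ V(G))
    (h : Relation.ReflTransGen (G.EarStep M) (G.induce (G.comp c)) H) :
    ∃ X, G.IsCrit m (G.comp c) X ∧ V(H) ⊆ X ∧ X ⊆ G.earReach M c := by
  induction h with
  | refl =>
    exact ⟨G.comp c, isCrit_comp, subset_rfl, comp_subset_earReach ⟨hc, .refl⟩⟩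
  | @tail H H' hH hHH' ih =>
    obtain ⟨X, hX, hHX, hXU⟩ := ih
    obtain ⟨h1, h2, P, hP, z, hzP, hz⟩ := hHH'
    obtain ⟨h, hhV, rfl⟩ := isFactorComponent_iff.1 h1
    obtain rfl := h2.eq_induce_comp hz
    have hzV : z ∈ V(G) := hP.1.1.vertexSet_mono hzP
    obtain ⟨p, hp, hcover⟩ := hP.exists_earList hm
    rw [vertexSet_induce] at hp hHX hcover
    have hX' := hp.isCrit hM hm hV
    refine ⟨_, hX.union hM hm hX' hHX, ?_, Set.union_subset hXU ?_⟩
    · refine Set.subset_union_of_subset_right (hX'.comp_subset z ?_) _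
      obtain hz | hz | hz := hcover z hzP
      · exact .inl hz
      · exact .inr ⟨z, hz, mem_comp_self hzV⟩
      · refine .inr ⟨m z, hz, ?_⟩
        simpa [hm.invol] using hm.mem_comp hM (mem_comp_self (hm.mem hzV))
    · rintro y (hy | ⟨x, hx, hy⟩)
      · exact hXU (hHX hy)
      · refine ⟨hy.1, ?_⟩
        rw [comp_eq hy]
        exact hH.tail (hp.earStep hM hm hhV hx)

lemma bal_earReach (hM : G.IsPerfectMatching M) (hm : G.IsMate M m) (hV : V(G).Finite)
    (hc : c ∈ V(G)) (hu : u ∈ G.earReach M c) :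
    Bal G.Adj m (G.earReach M c) (G.comp c) u := by
  obtain ⟨X, h1, h2, h3⟩ := exists_isCrit_of_reflTransGen hM hm hV hc hu.2
  exact (h1.bal u (h2 (mem_comp_self hu.1))).mono h3

lemma mate_mem_earReach (hM : G.IsPerfectMatching M) (hm : G.IsMate M m)
    (hu : u ∈ G.earReach M c) : m u ∈ G.earReach M c :=
  comp_subset_earReach hu (hm.mem_comp hM (mem_comp_self hu.1))

/-- There is no alternating ear relative to the set of all vertices that are reached by ears. -/
lemma not_earList_earReach (hM : G.IsPerfectMatching M) (hm : G.IsMate M m) (hV : V(G).Finite)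
    (hc : c ∈ V(G)) : ¬ EarList G.Adj m (G.earReach M c) p := by
  rintro ⟨hp0, hpnd, hpU, u, hu, w, hw, halt⟩
  have hUm : ∀ x ∈ G.earReach M c, m x ∈ G.earReach M c := fun x hx ↦ mate_mem_earReach hM hm hx
  have hUm' : ∀ x ∉ G.earReach M c, m x ∉ G.earReach M c := fun x hx h ↦
    hx (by simpa [hm.invol] using hUm _ h)
  have hCU : G.comp c ⊆ G.earReach M c := comp_subset_earReach ⟨hc, .refl⟩
  obtain ⟨y, p', rfl⟩ := List.exists_cons_of_ne_nil hp0
  -- no ear relative to a reached factor-component leaves the reached set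
  have hno : ∀ z ∈ G.earReach M c, ∀ l, EarList G.Adj m (G.comp z) l → ∀ x ∈ l,
      x ∈ G.earReach M c := fun z hz l hl x hx ↦
    have h := hl.earStep hM hm hz.1 hx
    ⟨h.2.2.elim fun P hP ↦ by
      obtain ⟨-, -, -, a, -, b, -, h⟩ := hl
      exact h.mem_vertexSet hx, hz.2.tail h⟩
  -- the path from `u` to the factor-component of `c`
  obtain ⟨r, hrnd, hrU, hr⟩ : ∃ r : List α, PairNodup m r ∧ (∀ t ∈ r, t ∈ G.earReach M c) ∧
      (r = [] ∧ u ∈ G.comp c ∨ ∃ r', r = u :: r' ∧ u ∉ G.comp c ∧ (∀ t ∈ r, t ∉ G.comp c) ∧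
        ∃ g ∈ G.comp c, Alt G.Adj m (m u) r' g) := by
    obtain h | ⟨l, g, h1, h2, h3, h4⟩ := bal_earReach hM hm hV hc hu
    · exact ⟨[], by simp [PairNodup], by simp, .inl ⟨rfl, h⟩⟩
    · exact ⟨u :: l, h3, fun t ht ↦ (h4 t ht).1, .inr ⟨l, rfl, (h4 u (by simp)).2,
        fun t ht ↦ (h4 t ht).2, g, h2, h1⟩⟩
  -- the ear, continued until it reaches this path or this factor-component
  obtain ⟨s, z, hs, hz, hsU, hsnd⟩ : ∃ s z, Alt G.Adj m u (y :: p' ++ s) z ∧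
      (z ∈ G.comp c ∨ z ∈ r ∨ m z ∈ r) ∧
      (∀ t ∈ s, t ∈ G.earReach M c ∧ ¬ (t ∈ G.comp c ∨ t ∈ r ∨ m t ∈ r)) ∧ PairNodup m s := by
    have h := (bal_earReach hM hm hV hc hw).superset
      (T := {t | t ∈ G.comp c ∨ t ∈ r ∨ m t ∈ r}) fun _ ↦ .inl
    obtain h | ⟨l, g, h1, h2, h3, h4⟩ := h
    · exact ⟨[], w, by simpa using halt, h, by simp, by simp [PairNodup]⟩
    · exact ⟨w :: l, g, alt_append.2 ⟨halt, h1⟩, h2, h4, h3⟩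
  have hpsnd : PairNodup m (y :: p' ++ s) := by
    refine (pairNodup_append hm.invol).2 ⟨hpnd, hsnd, fun a ha b hb ↦ ⟨?_, ?_⟩⟩
    · rintro rfl
      exact hpU _ ha (hsU _ hb).1
    · rintro rfl
      exact hpU _ ha (hUm _ (hsU _ hb).1)
  have hpsr : ∀ x ∈ y :: p' ++ s, x ∉ r ∧ m x ∉ r := by
    intro x hx
    obtain hx | hx := List.mem_append.1 hx
    · exact ⟨fun h ↦ hpU x hx (hrU x h), fun h ↦ hUm' x (hpU x hx) (hrU _ h)⟩
    · have h := (hsU x hx).2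
      tauto
  have hyU : y ∉ G.earReach M c := hpU y (by simp)
  -- Whenever the extended ear and the path `r` both lead to the factor-component of `z`, they form
  -- an ear relative to it that contains `y`, contrary to `hno`.
  have hfin : ∀ z ∈ G.earReach M c, Alt G.Adj m u (y :: p' ++ s) z →
      Bal G.Adj m {t | t ∈ r} (G.comp z) u → False := by
    intro z hz hs hb
    obtain ⟨l, hl, hpl⟩ := hb.exists_earList (fun _ _ h ↦ h.symm) hm.invol
      (fun x hx ↦ hm.mem_comp hM hx) hs (mem_comp_self hz.1) (by simp)
      (fun x hx h ↦ hpU x hx (comp_subset_earReach hz h)) hpsnd hpsr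
    exact hyU (hno z hz l hl y (hpl y (by simp)))
  obtain hz | hz := hz
  · refine hfin z (hCU hz) hs ?_
    rw [comp_eq hz]
    obtain ⟨-, hu⟩ | ⟨r', rfl, -, hrC, g, hg, hr⟩ := hr
    · exact .inl hu
    · exact .inr ⟨r', g, hr, hg, hrnd, fun t ht ↦ ⟨ht, hrC t ht⟩⟩
  obtain ⟨rfl, -⟩ | ⟨r', rfl, -, -, g, -, hr⟩ := hr
  · simp at hz
  obtain hz | hz := hz
  -- Both paths enter the pair of `z` at `z`, so `r` can be cut at its first vertex in the
  -- factor-component of `z`.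
  · refine hfin z (hrU z hz) hs ?_
    have hzz := mem_comp_self (hrU z hz).1
    obtain rfl | hz := List.mem_cons.1 hz
    · exact .inl hzz
    by_cases huz : u ∈ G.comp z
    · exact .inl huz
    obtain ⟨r₁, r₂, rfl⟩ := List.append_of_mem hz
    obtain ⟨l, b, h1, h2, h3, h4⟩ := (alt_append.1 hr).1.exists_prefix hzz
    have hsub : (u :: l).Sublist (u :: (r₁ ++ z :: r₂)) :=
      (h1.sublist.trans (List.sublist_append_left _ _)).cons_cons u
    refine .inr ⟨l, b, h2, h3, hrnd.sublist hsub, fun t ht ↦ ⟨hsub.subset ht, ?_⟩⟩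
    obtain rfl | ht := List.mem_cons.1 ht
    exacts [huz, h4 t ht]
  -- the remaining case: the edge from `u` to `y` lies on an alternating circuit
  obtain ⟨t, L, htr, htL, hL⟩ : ∃ t L : List α, t.Sublist (u :: r') ∧ (t.map m).reverse = L ++ [m u] ∧
      Alt G.Adj m u (y :: p' ++ s ++ L) (m u) := by
    obtain hz | hz := List.mem_cons.1 hz
    · refine ⟨[u], [], by simp, by simp, ?_⟩
      rwa [← hz, hm.invol, hz, List.append_nil]
    · obtain ⟨r₁, r₂, rfl⟩ := List.append_of_mem hz
      refine ⟨u :: (r₁ ++ [m z]), z :: (r₁.map m).reverse, ?_, by simp [hm.invol], ?_⟩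
      · refine List.Sublist.cons_cons u ?_
        exact List.Sublist.append_left (by simp) r₁
      · exact alt_append.2 ⟨hs, (alt_append.1 hr).1.reverse (fun _ _ h ↦ h.symm) hm.invol⟩
  have hnd : PairNodup m (m u :: y :: (p' ++ s ++ L)) := by
    have h : PairNodup m ((y :: p' ++ s) ++ (t.map m).reverse) := by
      refine (pairNodup_append hm.invol).2 ⟨hpsnd, (hrnd.sublist htr).reverse hm.invol,
        fun a ha b hb ↦ ?_⟩
      obtain ⟨d, hd, rfl⟩ := List.mem_map.1 (List.mem_reverse.1 hb)
      have h := hpsr a ha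
      constructor
      · rintro rfl
        rw [hm.invol] at h
        exact h.2 (htr.subset hd)
      · rw [hm.invol]
        rintro rfl
        exact h.1 (htr.subset hd)
    rw [htL, ← List.append_assoc] at h
    refine h.perm ?_
    simpa using List.perm_append_singleton (m u) (y :: (p' ++ (s ++ L)))
  obtain ⟨f, hf⟩ := hL.1
  have hal := hM.isAllowed_of_alt (x := y) (r := m u) (f := f) hm (l := p' ++ s ++ L)
    (by simpa using hL.2) hnd (fun v hv ↦ ?_) (by rw [hm.invol]; exact hf.symm)
  · exact hyU (comp_subset_earReach hu (hal.mem_comp hf (mem_comp_self hu.1)))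
  · obtain rfl | hv := List.mem_cons.1 hv
    · exact hm.mem hu.1
    · exact hL.mem_vertexSet (by simpa using hv)

/-- A path from `x` outside the reached set enters that set from some `m d`, also outside. The path
starting from `m d` with the same matching edge reaches the set in the other direction; the linking
edge and this second path form a forbidden ear. -/
lemma IsCrit.subset_earReach (hM : G.IsPerfectMatching M) (hm : G.IsMate M m) (hV : V(G).Finite)
    (hc : c ∈ V(G)) (hX : G.IsCrit m (G.comp c) X) : X ⊆ G.earReach M c := by
  have hCU : G.comp c ⊆ G.earReach M c := comp_subset_earReach ⟨hc, .refl⟩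
  intro x hx
  by_contra hxU
  obtain h | ⟨l, b, h1, h2, h3, h4⟩ := (hX.bal x hx).superset hCU
  · exact hxU h
  obtain ⟨d, hd, hdb⟩ := h1.exists_last
  have hdU : m d ∉ G.earReach M c := fun h ↦
    (h4 d hd).2 (by simpa [hm.invol] using mate_mem_earReach hM hm h)
  obtain h | ⟨l', w, g1, g2, g3, g4⟩ :=
    (hX.bal (m d) (hX.mate_mem hM hm (h4 d hd).1)).superset hCU
  · exact hdU h
  exact not_earList_earReach hM hm hV hc
    ⟨by simp, g3, fun y hy ↦ (g4 y hy).2, b, h2, w, g2, hdb.symm, g1⟩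

end EarSequence

/-- A chain of relations can be shortened to one without repetitions. -/
lemma exists_injective_of_reflTransGen {γ : Type*} {R : γ → γ → Prop} {a b : γ}
    (h : Relation.ReflTransGen R a b) : ∃ (k : ℕ) (f : Fin (k + 1) → γ), Function.Injective f ∧
      (∀ i : Fin k, R (f i.castSucc) (f i.succ)) ∧ f 0 = a ∧ f (Fin.last k) = b := by
  induction h with
  | refl => exact ⟨0, fun _ ↦ a, fun i j _ ↦ Fin.ext (by omega), fun i ↦ i.elim0, rfl, rfl⟩
  | @tail b c _ hbc ih =>
    obtain ⟨k, f, hf, hR, h0, hk⟩ := ih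
    -- If the new last term has already occurred, the chain is cut at that occurrence.
    by_cases hc : ∃ i, f i = c
    · obtain ⟨i, rfl⟩ := hc
      refine ⟨i, fun j ↦ f (Fin.castLE i.2 j), hf.comp (Fin.castLE_injective _), fun j ↦ ?_,
        h0, rfl⟩
      exact hR ⟨j, by omega⟩
    · refine ⟨k + 1, Fin.snoc (α := fun _ ↦ γ) f c, ?_, fun i ↦ ?_, ?_, by simp⟩
      · rw [Fin.snoc_injective_iff]
        exact ⟨hf, fun ⟨i, hi⟩ ↦ hc ⟨i, hi⟩⟩
      · induction i using Fin.lastCases with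
        | last => simpa [hk] using hbc
        | cast i =>
          rw [Fin.succ_castSucc, Fin.snoc_castSucc, Fin.snoc_castSucc]
          exact hR i
      · rw [← Fin.castSucc_zero, Fin.snoc_castSucc, h0]

end Graph

theorem mainTheorem2 {α β : Type*} (G : Graph α β) (hV : V(G).Finite) (hE : E(G).Finite)
    (M : Set β) (hM : G.IsPerfectMatching M) (G₁ G₂ : Graph α β)
    (h₁ : G.IsFactorComponent G₁) (h₂ : G.IsFactorComponent G₂) :
    G.Yields G₁ G₂ ↔
      ∃ (k : ℕ) (H : Fin (k + 1) → Graph α β),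
        G.IsMEarSequence M k H ∧ H 0 = G₁ ∧ H (Fin.last k) = G₂ := by
  obtain ⟨m, hm⟩ := hM.exists_isMate
  obtain ⟨c, hc, rfl⟩ := Graph.isFactorComponent_iff.1 h₁
  constructor
  · rintro ⟨X, hX⟩
    obtain ⟨hcrit, hG₂⟩ := (Graph.isCriticalInducing_iff hV hM hm).1 hX
    obtain ⟨z, hz, rfl⟩ := Graph.isFactorComponent_iff.1 h₂
    have hzU := hcrit.subset_earReach hM hm hV hc (hG₂ (Graph.mem_comp_self hz))
    obtain ⟨k, H, hinj, hstep, h0, hk⟩ := Graph.exists_injective_of_reflTransGen hzU.2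
    refine ⟨k, H, ⟨fun i ↦ ?_, hinj, fun i ↦ (hstep i).2.2⟩, h0, hk⟩
    induction i using Fin.cases with
    | zero => rwa [h0]
    | succ i => exact (hstep i).2.1
  · rintro ⟨k, H, ⟨hH, -, hear⟩, h0, rfl⟩
    have hreach : ∀ i, Relation.ReflTransGen (G.EarStep M) (H 0) (H i) := by
      intro i
      induction i using Fin.induction with
      | zero => exact .refl
      | succ i ih => exact ih.tail ⟨hH _, hH _, hear i⟩
    have hlast := hreach (Fin.last k)
    rw [h0] at hlast
    obtain ⟨X, h1, h2, -⟩ := Graph.exists_isCrit_of_reflTransGen hM hm hV hc hlast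
    exact ⟨X, (Graph.isCriticalInducing_iff hV hM hm).2 ⟨h1, h2⟩⟩
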